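/- Let $d,n\ge 1$ and $\lambda>0$, and let $H\in\mathcal M(n,\mathbb R)$ have all its (complex) eigenvalues of positive real part. For $c>0$ and a square matrix $A$ put $c^{A}=\exp((\log c)A)$, and put $0^{H}=0^{H^t}=0$ (the limit as $c\to0^+$). Let $Z$ be an $\mathbb R^n$-valued centered Gaussian independently scattered random measure on $\mathbb R^d$ with Lebesgue control measure: for some fixed positive semidefinite $Q$ (for instance $Q=I$), $Z(A)\sim N(0,\mathrm{Leb}(A)\,Q)$ for every Borel set $A$ of finite Lebesgue measure, $Z$ takes independent values on disjoint sets, and $Z$ is a.s. $\sigma$-additive. For every $\mu>0$ and $x\in\mathbb R^d$ the mean-square stochastic integral $$B_{H,\mu}(x)=\int_{\mathbb R^d}\Big[e^{-\mu\|x-y\|}\,\|x-y\|^{H-\frac d2 I}-e^{-\mu\|-y\|}\,\|-y\|^{H-\frac d2 I}\Big]\,Z(dy)$$ exists; the random field $B_{H,\mu}=\{B_{H,\mu}(x)\}_{x\in\mathbb R^d}$ is called an isotropic tempered operator fractional Brownian field. Then: (i) $B_{H,\lambda}$ is isotropic: for every orthogonal matrix $O\in O(d)$, the fields $\{B_{H,\lambda}(Ox)\}_{x\in\mathbb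 R^d}$ and $\{B_{H,\lambda}(x)\}_{x\in\mathbb R^d}$ have the same finite-dimensional distributions. (ii) $B_{H,\lambda}$ has finite second moments and, for all $x,x'\in\mathbb R^d$, $$\mathrm{Cov}[B_{H,\lambda}(x),B_{H,\lambda}(x')]=\tfrac12\Big[\|x\|^{H}C_x^2\|x\|^{H^t}+\|x'\|^{H}C_{x'}^2\|x'\|^{H^t}-\|x-x'\|^{H}C_{x-x'}^2\|x-x'\|^{H^t}\Big],$$ where, for $x\ne0$ and $e_1=(1,0,\dots,0)^t\in\mathbb R^d$, the matrix $$C_x^2=\mathbb E\big[B_{H,\|x\|\lambda}(e_1)\,B_{H,\|x\|\lambda}(e_1)^t\big]$$ is symmetric positive semidefinite and depends on $x$ only through $\|x\|$. A term of the form $\|0\|^{H}C_0^2\|0\|^{H^t}$ is $0$. -/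

import Mathlib

open MeasureTheory ProbabilityTheory Filter Topology

noncomputable section

/-- The power `c ^ A = exp ((log c) A)` of a number `c > 0` with a square matrix exponent `A`.
For `c ≤ 0` the value is set to `0`; only `c = 0` ever occurs. In the kernel below this concerns
a set of Lebesgue measure zero, and for a matrix `H` whose eigenvalues have positive real parts
`0` is the limit of `c ^ H` as `c → 0+`. -/
def matPow {n : ℕ} (c : ℝ) (A : Matrix (Fin n) (Fin n) ℝ) : Matrix (Fin n) (Fin n) ℝ :=
  if 0 < c then NormedSpace.exp (Real.log c • A) else 0

/-- A Hurst matrix: every (complex) eigenvalue has positive real part. -/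
def IsHurst {n : ℕ} (H : Matrix (Fin n) (Fin n) ℝ) : Prop :=
  ∀ z ∈ spectrum ℂ (H.map (algebraMap ℝ ℂ)), 0 < z.re

section RandomMeasure

variable {Ω : Type*} [MeasurableSpace Ω]

/-- `Z` is an `ℝⁿ`-valued centred Gaussian independently scattered random measure on `ℝᵈ` with
Lebesgue control measure, generated by the normal law `N(0, Q)`: on the Borel sets of finite
Lebesgue measure, `Z A` is a random vector with law `N(0, Leb(A) Q)`, `Z` takes independent values
on disjoint sets, and it is almost surely `σ`-additive (convergence of the partial sums along each
given sequence). The values of `Z` on other sets are irrelevant. -/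
structure IsGaussianISRM {d n : ℕ} (P : Measure Ω) (Q : Matrix (Fin n) (Fin n) ℝ)
    (Z : Set (EuclideanSpace ℝ (Fin d)) → Ω → EuclideanSpace ℝ (Fin n)) : Prop where
  measurable : ∀ A, MeasurableSet A → volume A < ⊤ → Measurable (Z A)
  law : ∀ A, MeasurableSet A → volume A < ⊤ →
    P.map (Z A) = multivariateGaussian 0 ((volume A).toReal • Q)
  indep : ∀ A : ℕ → Set (EuclideanSpace ℝ (Fin d)),
    (∀ k, MeasurableSet (A k)) → (∀ k, volume (A k) < ⊤) →
    Pairwise (fun i j => Disjoint (A i) (A j)) → iIndepFun (fun k => Z (A k)) P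
  sigma_additive : ∀ A : ℕ → Set (EuclideanSpace ℝ (Fin d)),
    (∀ k, MeasurableSet (A k)) → volume (⋃ k, A k) < ⊤ →
    Pairwise (fun i j => Disjoint (A i) (A j)) →
    ∀ᵐ ω ∂P, Tendsto (fun N => ∑ k ∈ Finset.range N, Z (A k) ω) atTop (𝓝 (Z (⋃ k, A k) ω))

/-- The integral `∑_R R Z({s = R})` of a simple matrix-valued function `s` (the value `R = 0`
contributes `0`). -/
def simpleStochInt {d n : ℕ} (Z : Set (EuclideanSpace ℝ (Fin d)) → Ω → EuclideanSpace ℝ (Fin n))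
    (s : SimpleFunc (EuclideanSpace ℝ (Fin d)) (Matrix (Fin n) (Fin n) ℝ)) (ω : Ω) :
    EuclideanSpace ℝ (Fin n) :=
  ∑ R ∈ s.range, Matrix.toEuclideanLin R (Z (s ⁻¹' {R}) ω)

/-- `X` is (a version of) the stochastic integral `∫ f(y) Z(dy)` of the deterministic matrix-valued
function `f` with square integrable entries: the mean square limit of the integrals of simple
functions, vanishing outside sets of finite measure, that converge to `f` in mean square. -/
def IsStochInt {d n : ℕ} (P : Measure Ω)
    (Z : Set (EuclideanSpace ℝ (Fin d)) → Ω → EuclideanSpace ℝ (Fin n))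
    (f : EuclideanSpace ℝ (Fin d) → Matrix (Fin n) (Fin n) ℝ)
    (X : Ω → EuclideanSpace ℝ (Fin n)) : Prop :=
  (∀ i j, MemLp (fun y => f y i j) 2 volume) ∧ MemLp X 2 P ∧
  ∃ s : ℕ → SimpleFunc (EuclideanSpace ℝ (Fin d)) (Matrix (Fin n) (Fin n) ℝ),
    (∀ k, (s k).FinMeasSupp volume) ∧
    (∀ i j, Tendsto (fun k => eLpNorm (fun y => s k y i j - f y i j) 2 volume) atTop (𝓝 0)) ∧
    Tendsto (fun k => eLpNorm (fun ω => simpleStochInt Z (s k) ω - X ω) 2 P) atTop (𝓝 0)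

open Classical in
/-- The stochastic integral `∫ f(y) Z(dy)`; it is determined up to almost sure equality, and a
version is chosen. (It is `0` if the integral does not exist.) -/
def stochInt {d n : ℕ} (P : Measure Ω)
    (Z : Set (EuclideanSpace ℝ (Fin d)) → Ω → EuclideanSpace ℝ (Fin n))
    (f : EuclideanSpace ℝ (Fin d) → Matrix (Fin n) (Fin n) ℝ) : Ω → EuclideanSpace ℝ (Fin n) :=
  if h : ∃ X, IsStochInt P Z f X then h.choose else 0

/-- The kernel
`y ↦ e^{-lam ‖x - y‖} ‖x - y‖^{H - (d/2) I} - e^{-lam ‖-y‖} ‖-y‖^{H - (d/2) I}`. -/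
def itofbfKernel {d n : ℕ} (H : Matrix (Fin n) (Fin n) ℝ) (lam : ℝ)
    (x y : EuclideanSpace ℝ (Fin d)) : Matrix (Fin n) (Fin n) ℝ :=
  Real.exp (-lam * ‖x - y‖) • matPow ‖x - y‖ (H - ((d : ℝ) / 2) • 1) -
    Real.exp (-lam * ‖-y‖) • matPow ‖-y‖ (H - ((d : ℝ) / 2) • 1)

/-- `B` is an isotropic tempered operator fractional Brownian field with Hurst matrix `H` and
tempering parameter `lam`, driven by `Z`: for every `x`, `B x` is a version of the stochastic
integral of the kernel at `x`. -/
def IsITOFBF {d n : ℕ} (P : Measure Ω)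
    (Z : Set (EuclideanSpace ℝ (Fin d)) → Ω → EuclideanSpace ℝ (Fin n))
    (H : Matrix (Fin n) (Fin n) ℝ) (lam : ℝ)
    (B : EuclideanSpace ℝ (Fin d) → Ω → EuclideanSpace ℝ (Fin n)) : Prop :=
  ∀ x, IsStochInt P Z (itofbfKernel H lam x) (B x)

/-- The field `B_{H,lam}` driven by `Z`. -/
def itofbf {d n : ℕ} (P : Measure Ω)
    (Z : Set (EuclideanSpace ℝ (Fin d)) → Ω → EuclideanSpace ℝ (Fin n))
    (H : Matrix (Fin n) (Fin n) ℝ) (lam : ℝ) (x : EuclideanSpace ℝ (Fin d)) :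
    Ω → EuclideanSpace ℝ (Fin n) :=
  stochInt P Z (itofbfKernel H lam x)

/-- Isotropy: for every orthogonal matrix `O`, the fields `x ↦ X (O x)` and `x ↦ X x` have the same
finite-dimensional distributions. -/
def IsIsotropicField {d n : ℕ} (P : Measure Ω)
    (X : EuclideanSpace ℝ (Fin d) → Ω → EuclideanSpace ℝ (Fin n)) : Prop :=
  ∀ O ∈ Matrix.orthogonalGroup (Fin d) ℝ, ∀ (m : ℕ) (x : Fin m → EuclideanSpace ℝ (Fin d)),
    IdentDistrib (fun ω (k : Fin m) => X (Matrix.toEuclideanLin O (x k)) ω)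
      (fun ω (k : Fin m) => X (x k) ω) P P

/-- The covariance matrix `Cov[X, Y] = E[(X - EX)(Y - EY)ᵗ]` of two random vectors. -/
def covMatrix {n : ℕ} (P : Measure Ω) (X Y : Ω → EuclideanSpace ℝ (Fin n)) :
    Matrix (Fin n) (Fin n) ℝ :=
  Matrix.of fun i j => cov[fun ω => X ω i, fun ω => Y ω j; P]

/-- The matrix `E[X Xᵗ]` of second moments of a random vector. -/
def secondMoment {n : ℕ} (P : Measure Ω) (X : Ω → EuclideanSpace ℝ (Fin n)) :
    Matrix (Fin n) (Fin n) ℝ :=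
  Matrix.of fun i j => ∫ ω, X ω i * X ω j ∂P

/-- The matrix `C²_x = E[B_{H,‖x‖lam}(e₁) B_{H,‖x‖lam}(e₁)ᵗ]` as a function of the radius
`r = ‖x‖`, where `e₁ = (1, 0, …, 0)ᵗ ∈ ℝᵈ`. -/
def radialC2 {d n : ℕ} [NeZero d] (P : Measure Ω)
    (Z : Set (EuclideanSpace ℝ (Fin d)) → Ω → EuclideanSpace ℝ (Fin n))
    (H : Matrix (Fin n) (Fin n) ℝ) (lam r : ℝ) : Matrix (Fin n) (Fin n) ℝ :=
  secondMoment P (itofbf P Z H (r * lam) (EuclideanSpace.single 0 1))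

end RandomMeasure

end

/-! Everything reduces to the matrices `kernelCov Q f g`, that is `∫ f Q gᵗ`. From `E[Z_i(A) Z_j(B)]
= Leb(A ∩ B) Q_ij`, the map `φ ↦ ∫ φ dZ_j` extends from step functions to `L²` with `E[∫ φ dZ_i ∫ ψ
dZ_j] = Q_ij ⟨φ, ψ⟩` (`inner_wienerInt`). Every version of a stochastic integral is a coordinatewise
sum of such integrals (`IsStochInt.ae_eq`), finite families of them are jointly centred Gaussian
(`charFunDual_of_isStochInt`), and so their joint law depends only on the `kernelCov` of pairs.

The kernel is `K(x - y) - K(-y)` with `K` radial, and the rest is change of variables in Lebesgue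
measure. Orthogonal maps give isotropy. Dilation by `r` turns `K` with parameter `λ` into `r^{-d/2}
r^H K` with parameter `rλ`; the scalar factor cancels the Jacobian, so after rotating `x` to `‖x‖
e₁` the variance at `x` is `‖x‖^H C_x² ‖x‖^{Hᵗ}`. Translation makes the increments stationary.
Polarization then gives only the sum of the cross-covariance and its transpose; the two agree
because a point reflection exchanges the two arguments (`kernelCov_temperedPow_symm`).

The integrals exist because `K` is square integrable (`memLp_temperedPow`): the eigenvalue condition
bounds `r^H` by a positive power near `0`, and tempering handles infinity. -/

noncomputable section RandomMeasureIntegral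

variable {Ω : Type*} [MeasurableSpace Ω] {P : Measure Ω} {d n : ℕ}
  {Q : Matrix (Fin n) (Fin n) ℝ} {Z : Set (EuclideanSpace ℝ (Fin d)) → Ω → EuclideanSpace ℝ (Fin n)}

/-! ### Second-order structure of the random measure and scalar Wiener integrals -/

namespace IsGaussianISRM

variable {A B : Set (EuclideanSpace ℝ (Fin d))}

lemma memLp (hZ : IsGaussianISRM P Q Z) (hA : MeasurableSet A) (hA' : volume A < ⊤) (j : Fin n) :
    MemLp (fun ω => Z A ω j) 2 P := by
  have h : MemLp (fun x : EuclideanSpace ℝ (Fin n) => x j) 2 (P.map (Z A)) := by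
    rw [hZ.law A hA hA']
    have := IsGaussian.memLp_two_id (μ := multivariateGaussian 0 ((volume A).toReal • Q))
    exact (EuclideanSpace.proj (𝕜 := ℝ) j).comp_memLp' this
  exact (memLp_map_measure_iff h.1 (hZ.measurable A hA hA').aemeasurable).1 h

lemma integral_apply (hZ : IsGaussianISRM P Q Z) (hA : MeasurableSet A) (hA' : volume A < ⊤)
    (j : Fin n) : ∫ ω, Z A ω j ∂P = 0 := by
  have h := integral_map (μ := P) (hZ.measurable A hA hA').aemeasurable
    (f := fun x : EuclideanSpace ℝ (Fin n) => x j) (by fun_prop)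
  rw [← h, hZ.law A hA hA']
  have := (EuclideanSpace.proj (𝕜 := ℝ) j).integral_comp_comm
    (IsGaussian.integrable_id (μ := multivariateGaussian 0 ((volume A).toReal • Q)))
  simpa using this

lemma integral_mul_same [IsProbabilityMeasure P] (hQ : Q.PosSemidef) (hZ : IsGaussianISRM P Q Z)
    (hA : MeasurableSet A) (hA' : volume A < ⊤) (i j : Fin n) :
    ∫ ω, Z A ω i * Z A ω j ∂P = volume.real A * Q i j := by
  have h := covariance_eval_multivariateGaussian (μ := 0)
    (hQ.smul (ENNReal.toReal_nonneg (a := volume A))) i j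
  rw [← hZ.law A hA hA', covariance_map (by fun_prop) (by fun_prop)
    (hZ.measurable A hA hA').aemeasurable] at h
  have h2 := covariance_eq_sub (hZ.memLp hA hA' i) (hZ.memLp hA hA' j)
  simp only [hZ.integral_apply hA hA', mul_zero, sub_zero] at h2
  exact h2.symm.trans h

/-- The law `N(0, 0)` is a point mass. This allows finite families to be padded by `∅` to the
sequences required by `sigma_additive`. -/
lemma ae_empty (hZ : IsGaussianISRM P Q Z) : Z ∅ =ᵐ[P] 0 := by
  have h := hZ.law ∅ .empty (by simp)
  have h0 : multivariateGaussian (0 : EuclideanSpace ℝ (Fin n)) ((volume (∅ : Set (EuclideanSpace ℝ (Fin d)))).toReal • Q)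
      = Measure.dirac 0 := by
    apply Measure.ext_of_charFun
    ext t
    simp [charFun_multivariateGaussian, Matrix.PosSemidef.zero]
  have hm := hZ.measurable ∅ .empty (by simp)
  rw [h0] at h
  have : ∀ᵐ x ∂(P.map (Z ∅)), x = 0 := by rw [h]; simp [ae_dirac_eq]
  exact ae_of_ae_map hm.aemeasurable this

lemma indepFun_of_disjoint (hZ : IsGaussianISRM P Q Z) (hA : MeasurableSet A) (hA' : volume A < ⊤)
    (hB : MeasurableSet B) (hB' : volume B < ⊤) (hAB : Disjoint A B) :
    IndepFun (Z A) (Z B) P := by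
  let S : ℕ → Set (EuclideanSpace ℝ (Fin d)) := fun k => if k = 0 then A else if k = 1 then B else ∅
  have h := hZ.indep S (fun k => by dsimp only [S]; split_ifs <;> simp [*])
    (fun k => by dsimp only [S]; split_ifs <;> simp [*]) (fun i j hij => by
      dsimp only [S]; split_ifs <;> simp_all [hAB.symm])
  exact h.indepFun (i := 0) (j := 1) (by norm_num)

lemma ae_union (hZ : IsGaussianISRM P Q Z) (hA : MeasurableSet A) (hA' : volume A < ⊤)
    (hB : MeasurableSet B) (hB' : volume B < ⊤) (hAB : Disjoint A B) :
    ∀ᵐ ω ∂P, Z (A ∪ B) ω = Z A ω + Z B ω := by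
  let S : ℕ → Set (EuclideanSpace ℝ (Fin d)) := fun k => if k = 0 then A else if k = 1 then B else ∅
  have hU : ⋃ k, S k = A ∪ B := by
    ext y
    simp only [Set.mem_iUnion, Set.mem_union, S]
    constructor
    · rintro ⟨k, hk⟩
      split_ifs at hk <;> simp_all
    · rintro (h | h)
      · exact ⟨0, by simpa⟩
      · exact ⟨1, by simpa⟩
  have h := hZ.sigma_additive S (fun k => by dsimp only [S]; split_ifs <;> simp [*])
    (by rw [hU]; exact measure_union_lt_top hA' hB') (fun i j hij => by
      dsimp only [S]; split_ifs <;> simp_all [hAB.symm])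
  rw [hU] at h
  filter_upwards [h, hZ.ae_empty] with ω hω h0
  refine tendsto_nhds_unique hω (tendsto_atTop_of_eventually_const (i₀ := 2) fun N hN => ?_)
  obtain ⟨M, rfl⟩ := Nat.exists_eq_add_of_le hN
  rw [Finset.sum_range_add]
  simp [S, Finset.sum_range_succ, h0, add_comm 2]

lemma integral_mul_disjoint [IsProbabilityMeasure P] (hZ : IsGaussianISRM P Q Z)
    (hA : MeasurableSet A) (hA' : volume A < ⊤)
    (hB : MeasurableSet B) (hB' : volume B < ⊤) (hAB : Disjoint A B) (i j : Fin n) :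
    ∫ ω, Z A ω i * Z B ω j ∂P = 0 := by
  have h := hZ.indepFun_of_disjoint hA hA' hB hB' hAB
  have h2 : IndepFun (fun ω => Z A ω i) (fun ω => Z B ω j) P :=
    h.comp (φ := fun x : EuclideanSpace ℝ (Fin n) => x i)
      (ψ := fun x : EuclideanSpace ℝ (Fin n) => x j) (by fun_prop) (by fun_prop)
  rw [h2.integral_fun_mul_eq_mul_integral (hZ.memLp hA hA' i).1 (hZ.memLp hB hB' j).1,
    hZ.integral_apply hA hA', zero_mul]

/-- Splitting `A` and `B` along `A ∩ B` leaves four products; three involve disjoint sets and have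
mean zero by independence. -/
lemma integral_mul [IsProbabilityMeasure P] (hQ : Q.PosSemidef) (hZ : IsGaussianISRM P Q Z)
    (hA : MeasurableSet A) (hA' : volume A < ⊤)
    (hB : MeasurableSet B) (hB' : volume B < ⊤) (i j : Fin n) :
    ∫ ω, Z A ω i * Z B ω j ∂P = volume.real (A ∩ B) * Q i j := by
  have hI : volume (A ∩ B) < ⊤ := (measure_mono Set.inter_subset_left).trans_lt hA'
  have hD : volume (A \ B) < ⊤ := (measure_mono Set.sdiff_subset).trans_lt hA'
  have hE : volume (B \ A) < ⊤ := (measure_mono Set.sdiff_subset).trans_lt hB'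
  have mI := hA.inter hB
  have mD := hA.diff hB
  have mE := hB.diff hA
  have dDI : Disjoint (A ∩ B) (A \ B) := Set.disjoint_sdiff_inter.symm
  have dEI : Disjoint (A ∩ B) (B \ A) := by
    rw [Set.inter_comm]; exact Set.disjoint_sdiff_inter.symm
  have dDE : Disjoint (A \ B) (B \ A) := disjoint_sdiff_sdiff
  have e1 := hZ.ae_union mI hI mD hD dDI
  have e2 := hZ.ae_union mI hI mE hE dEI
  rw [Set.inter_union_sdiff] at e1
  rw [Set.inter_comm, Set.inter_union_sdiff, Set.inter_comm] at e2
  have key : (fun ω => Z A ω i * Z B ω j) =ᵐ[P] fun ω =>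
      (Z (A ∩ B) ω i * Z (A ∩ B) ω j + Z (A ∩ B) ω i * Z (B \ A) ω j) +
      (Z (A \ B) ω i * Z (A ∩ B) ω j + Z (A \ B) ω i * Z (B \ A) ω j) := by
    filter_upwards [e1, e2] with ω h1 h2
    rw [h1, h2]
    simp only [PiLp.add_apply]
    ring
  have int {S T} (hS : MeasurableSet S) (hS' : volume S < ⊤) (hT : MeasurableSet T)
      (hT' : volume T < ⊤) : Integrable (fun ω => Z S ω i * Z T ω j) P :=
    (hZ.memLp hS hS' i).integrable_mul (hZ.memLp hT hT' j)
  have int2 {f g : Ω → ℝ} (hf : Integrable f P) (hg : Integrable g P) :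
    Integrable (fun ω => f ω + g ω) P := hf.add hg
  rw [integral_congr_ae key, integral_add (int2 (int mI hI mI hI) (int mI hI mE hE))
    (int2 (int mD hD mI hI) (int mD hD mE hE)), integral_add (int mI hI mI hI) (int mI hI mE hE),
    integral_add (int mD hD mI hI) (int mD hD mE hE), hZ.integral_mul_same hQ mI hI,
    hZ.integral_mul_disjoint mI hI mE hE dEI, hZ.integral_mul_disjoint mD hD mI hI dDI.symm,
    hZ.integral_mul_disjoint mD hD mE hE dDE]
  ring

end IsGaussianISRM

/-- The Borel sets of finite Lebesgue measure. -/
abbrev FinMeasSet (d : ℕ) : Type :=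
  {A : Set (EuclideanSpace ℝ (Fin d)) // MeasurableSet A ∧ volume A < ⊤}

/-- Formal linear combinations of sets, as step functions in `L²(ℝᵈ)`. -/
def stepLp (d : ℕ) : (FinMeasSet d →₀ ℝ) →ₗ[ℝ] Lp ℝ 2 (volume : Measure (EuclideanSpace ℝ (Fin d))) :=
  Finsupp.linearCombination ℝ fun A => indicatorConstLp 2 A.2.1 A.2.2.ne (1 : ℝ)

lemma denseRange_stepLp : DenseRange (stepLp d) := by
  have h : ∀ f : Lp ℝ 2 (volume : Measure (EuclideanSpace ℝ (Fin d))),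
      f ∈ (LinearMap.range (stepLp d)).topologicalClosure := by
    intro f
    refine Lp.induction (p := 2) (by simp) (motive := fun f =>
      f ∈ (LinearMap.range (stepLp d)).topologicalClosure) ?_ ?_ ?_ f
    · intro c s hs hμs
      refine Submodule.le_topologicalClosure _ ⟨Finsupp.single ⟨s, hs, hμs⟩ c, ?_⟩
      rw [stepLp, Finsupp.linearCombination_single, Lp.simpleFunc.coe_indicatorConst]
      ext1
      filter_upwards [Lp.coeFn_smul c (indicatorConstLp 2 hs hμs.ne (1 : ℝ)),
        indicatorConstLp_coeFn (p := 2) (hs := hs) (hμs := hμs.ne) (c := (1 : ℝ)),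
        indicatorConstLp_coeFn (p := 2) (hs := hs) (hμs := hμs.ne) (c := c)] with y h1 h2 h3
      rw [h1, h3, Pi.smul_apply, h2]
      by_cases hy : y ∈ s <;> simp [hy]
    · intro f g hf hg _ h1 h2
      exact add_mem h1 h2
    · exact Submodule.isClosed_topologicalClosure _
  intro f
  exact h f

namespace IsGaussianISRM

variable [IsProbabilityMeasure P]

/-- The `j`-th coordinate of the integrals of step functions. -/
def stepInt (hZ : IsGaussianISRM P Q Z) (j : Fin n) : (FinMeasSet d →₀ ℝ) →ₗ[ℝ] Lp ℝ 2 P :=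
  Finsupp.linearCombination ℝ fun A => (hZ.memLp A.2.1 A.2.2 j).toLp

/-- By bilinearity only indicators matter. Working with formal combinations makes `stepInt` linear
for free; this identity then shows that it is bounded by the norm of the step function, hence
factors through `stepLp` and extends to `L²`. -/
lemma inner_stepInt (hQ : Q.PosSemidef) (hZ : IsGaussianISRM P Q Z) (i j : Fin n)
    (a b : FinMeasSet d →₀ ℝ) :
    inner ℝ (hZ.stepInt i a) (hZ.stepInt j b) = Q i j * inner ℝ (stepLp d a) (stepLp d b) := by
  simp only [stepInt, stepLp, Finsupp.linearCombination_apply, Finsupp.sum, sum_inner, inner_sum,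
    Finset.mul_sum, real_inner_smul_left, real_inner_smul_right]
  refine Finset.sum_congr rfl fun B _ => Finset.sum_congr rfl fun A _ => ?_
  rw [L2.real_inner_indicatorConstLp_one_indicatorConstLp_one A.2.1 B.2.1 A.2.2.ne B.2.2.ne,
    L2.inner_def]
  have : ∫ ω, inner ℝ ((hZ.memLp A.2.1 A.2.2 i).toLp _ ω) ((hZ.memLp B.2.1 B.2.2 j).toLp _ ω) ∂P
      = ∫ ω, Z A ω i * Z B ω j ∂P := by
    refine integral_congr_ae ?_
    filter_upwards [(hZ.memLp A.2.1 A.2.2 i).coeFn_toLp, (hZ.memLp B.2.1 B.2.2 j).coeFn_toLp]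
      with ω h1 h2
    rw [h1, h2]
    simp [mul_comm]
  rw [this, hZ.integral_mul hQ A.2.1 A.2.2 B.2.1 B.2.2]
  ring

lemma norm_stepInt_le (hQ : Q.PosSemidef) (hZ : IsGaussianISRM P Q Z) (j : Fin n)
    (a : FinMeasSet d →₀ ℝ) : ‖hZ.stepInt j a‖ ≤ √(Q j j) * ‖stepLp d a‖ := by
  have h := hZ.inner_stepInt hQ j j a a
  rw [real_inner_self_eq_norm_sq, real_inner_self_eq_norm_sq] at h
  rw [← Real.sqrt_sq (norm_nonneg (hZ.stepInt j a)), h, Real.sqrt_mul' _ (sq_nonneg _),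
    Real.sqrt_sq (norm_nonneg _)]

/-- The `L²`-isometry (up to a factor) `φ ↦ ∫ φ dZ_j` for scalar square integrable `φ`. -/
def wienerInt (hZ : IsGaussianISRM P Q Z) (j : Fin n) :
    Lp ℝ 2 (volume : Measure (EuclideanSpace ℝ (Fin d))) →L[ℝ] Lp ℝ 2 P :=
  (hZ.stepInt j).extendOfNorm (stepLp d)

lemma wienerInt_stepLp (hQ : Q.PosSemidef) (hZ : IsGaussianISRM P Q Z) (j : Fin n)
    (a : FinMeasSet d →₀ ℝ) : hZ.wienerInt j (stepLp d a) = hZ.stepInt j a :=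
  LinearMap.extendOfNorm_eq denseRange_stepLp ⟨_, hZ.norm_stepInt_le hQ j⟩ a

lemma inner_wienerInt (hQ : Q.PosSemidef) (hZ : IsGaussianISRM P Q Z) (i j : Fin n)
    (φ ψ : Lp ℝ 2 (volume : Measure (EuclideanSpace ℝ (Fin d)))) :
    inner ℝ (hZ.wienerInt i φ) (hZ.wienerInt j ψ) = Q i j * inner ℝ φ ψ := by
  refine denseRange_stepLp.induction_on₂ (p := fun φ ψ =>
    inner ℝ (hZ.wienerInt i φ) (hZ.wienerInt j ψ) = Q i j * inner ℝ φ ψ) ?_ ?_ φ ψ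
  · exact isClosed_eq (by fun_prop) (by fun_prop)
  · intro a b
    rw [wienerInt_stepLp hQ, wienerInt_stepLp hQ, hZ.inner_stepInt hQ]

lemma wienerInt_indicator (hQ : Q.PosSemidef) (hZ : IsGaussianISRM P Q Z) (j : Fin n)
    {A : Set (EuclideanSpace ℝ (Fin d))} (hA : MeasurableSet A) (hA' : volume A < ⊤) :
    hZ.wienerInt j (indicatorConstLp 2 hA hA'.ne (1 : ℝ)) = (hZ.memLp hA hA' j).toLp := by
  have := hZ.wienerInt_stepLp hQ j (Finsupp.single ⟨A, hA, hA'⟩ 1)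
  simpa [stepLp, stepInt] using this

lemma integral_wienerInt (hQ : Q.PosSemidef) (hZ : IsGaussianISRM P Q Z) (j : Fin n)
    (φ : Lp ℝ 2 (volume : Measure (EuclideanSpace ℝ (Fin d)))) :
    ∫ ω, hZ.wienerInt j φ ω ∂P = 0 := by
  -- The mean is the inner product with the constant `1`, hence continuous in `φ`, and density
  -- applies.
  have h : inner ℝ (indicatorConstLp 2 (μ := P) .univ (measure_ne_top _ _) (1 : ℝ))
      (hZ.wienerInt j φ) = 0 := by
    refine denseRange_stepLp.induction_on (p := fun φ =>
      inner ℝ (indicatorConstLp 2 (μ := P) .univ (measure_ne_top _ _) (1 : ℝ))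
        (hZ.wienerInt j φ) = 0) φ ?_ ?_
    · exact isClosed_eq (by fun_prop) (by fun_prop)
    · intro a
      rw [wienerInt_stepLp hQ]
      simp only [stepInt, Finsupp.linearCombination_apply, Finsupp.sum, inner_sum,
        real_inner_smul_right]
      refine Finset.sum_eq_zero fun A _ => ?_
      rw [L2.inner_indicatorConstLp_one, setIntegral_univ,
        integral_congr_ae (hZ.memLp A.2.1 A.2.2 j).coeFn_toLp, hZ.integral_apply A.2.1 A.2.2,
        mul_zero]
  rwa [L2.inner_indicatorConstLp_one, setIntegral_univ] at h

end IsGaussianISRM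

end RandomMeasureIntegral

/-! ### Matrix-valued stochastic integrals as sums of Wiener integrals -/

noncomputable section StochasticIntegral

variable {Ω : Type*} [MeasurableSpace Ω] {P : Measure Ω} {d n : ℕ}
  {Q : Matrix (Fin n) (Fin n) ℝ} {Z : Set (EuclideanSpace ℝ (Fin d)) → Ω → EuclideanSpace ℝ (Fin n)}

namespace MeasureTheory

section Approximation

variable {α V : Type*} [MeasurableSpace α] {μ : Measure α}

lemma MemLp.exists_seq_simpleFunc_tendsto [NormedAddCommGroup V] {f : α → V} (hf : MemLp f 2 μ) :
    ∃ s : ℕ → SimpleFunc α V, (∀ k, MemLp (s k) 2 μ) ∧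
      Tendsto (fun k => eLpNorm (fun y => s k y - f y) 2 μ) atTop (𝓝 0) := by
  have h : ∀ k : ℕ, ∃ g : SimpleFunc α V, eLpNorm (f - ⇑g) 2 μ < ((k : ENNReal) + 1)⁻¹ ∧
      MemLp g 2 μ := fun k => hf.exists_simpleFunc_eLpNorm_sub_lt (by simp) (by simp)
  choose s hs hs' using h
  refine ⟨s, hs', ?_⟩
  have h0 : Tendsto (fun k : ℕ => ((k : ENNReal) + 1)⁻¹) atTop (𝓝 0) := by
    have := (tendsto_add_atTop_iff_nat 1).2 ENNReal.tendsto_inv_nat_nhds_zero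
    simpa using this
  refine tendsto_of_tendsto_of_tendsto_of_le_of_le tendsto_const_nhds h0 (fun _ => zero_le) fun k => ?_
  have : (fun y => s k y - f y) = -(f - ⇑(s k)) := by ext y; simp
  rw [this, eLpNorm_neg]
  exact (hs k).le

/-- The nonzero values of a simple function. -/
def SimpleFunc.nonzeroRange [Zero V] (s : SimpleFunc α V) : Finset V :=
  open Classical in s.range.filter (· ≠ 0)

lemma SimpleFunc.nonzeroRange_lt_top [Zero V] {s : SimpleFunc α V} (hs : s.FinMeasSupp μ)
    (v : s.nonzeroRange) : μ (s ⁻¹' {(v : V)}) < ⊤ := by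
  have h : (v : V) ≠ 0 := by
    have := v.2
    simp only [SimpleFunc.nonzeroRange, Finset.mem_filter] at this
    exact this.2
  exact (SimpleFunc.finMeasSupp_iff.1 hs) _ h

/-- The fibre over `0` may have infinite measure, where nothing is known about `Z`, so it must leave
the sum. -/
lemma SimpleFunc.sum_range_eq_sum_nonzeroRange [Zero V] {M : Type*} [AddCommMonoid M]
    (s : SimpleFunc α V) (F : V → M) (hF : F 0 = 0) :
    ∑ v ∈ s.range, F v = ∑ v : s.nonzeroRange, F v := by
  classical
  rw [Finset.sum_coe_sort s.nonzeroRange F, SimpleFunc.nonzeroRange, Finset.sum_filter]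
  refine Finset.sum_congr rfl fun v _ => ?_
  split_ifs with h
  · rfl
  · rw [not_not.1 h, hF]

/-- The function `g` will be an entry or a coordinate: all entries of `s` are thus expanded over one
common partition, the fibres of `s` itself. -/
lemma SimpleFunc.toLp_comp_eq_sum [Zero V] {s : SimpleFunc α V} (hs : s.FinMeasSupp μ)
    {g : V → ℝ} (hg : g 0 = 0) (hm : MemLp (fun y => g (s y)) 2 μ) :
    hm.toLp = ∑ v : s.nonzeroRange, g v • indicatorConstLp 2 (s.measurableSet_fiber v)
      (nonzeroRange_lt_top hs v).ne (1 : ℝ) := by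
  ext1
  have h1 : ∀ᵐ y ∂μ, ∀ v : s.nonzeroRange, (g v • indicatorConstLp 2 (s.measurableSet_fiber v)
      (nonzeroRange_lt_top hs v).ne (1 : ℝ) : Lp ℝ 2 μ) y =
        g v * (s ⁻¹' {(v : V)}).indicator (fun _ => (1 : ℝ)) y := by
    rw [ae_all_iff]
    intro v
    filter_upwards [Lp.coeFn_smul (g v) (indicatorConstLp 2 (s.measurableSet_fiber v)
      (nonzeroRange_lt_top hs v).ne (1 : ℝ)), indicatorConstLp_coeFn (p := 2)
      (hs := s.measurableSet_fiber (v : V)) (hμs := (nonzeroRange_lt_top hs v).ne) (c := (1 : ℝ))]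
      with y h h'
    rw [h, Pi.smul_apply, h', smul_eq_mul]
  filter_upwards [hm.coeFn_toLp, h1, Lp.coeFn_finsetSum Finset.univ
    fun v : s.nonzeroRange => (g v • indicatorConstLp 2 (s.measurableSet_fiber v)
      (nonzeroRange_lt_top hs v).ne (1 : ℝ) : Lp ℝ 2 μ)] with y h h1 h2
  rw [h, h2, Finset.sum_apply, Finset.sum_congr rfl fun v _ => h1 v]
  rw [← s.sum_range_eq_sum_nonzeroRange
    (fun v => g v * (s ⁻¹' {v}).indicator (fun _ => (1 : ℝ)) y) (by simp [hg])]
  rw [Finset.sum_eq_single (s y)]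
  · simp
  · intro v _ hv
    rw [Set.indicator_of_notMem, mul_zero]
    simpa using hv.symm
  · intro h
    exact absurd (s.mem_range_self y) h

end Approximation

end MeasureTheory

namespace IsGaussianISRM

variable [IsProbabilityMeasure P]

lemma wienerInt_simpleFunc (hQ : Q.PosSemidef) (hZ : IsGaussianISRM P Q Z) (j : Fin n)
    {V : Type*} [Zero V] {s : SimpleFunc (EuclideanSpace ℝ (Fin d)) V} (hs : s.FinMeasSupp volume)
    {g : V → ℝ} (hg : g 0 = 0) (hm : MemLp (fun y => g (s y)) 2 volume) :
    ∀ᵐ ω ∂P, hZ.wienerInt j hm.toLp ω = ∑ v : s.nonzeroRange, g v * Z (s ⁻¹' {(v : V)}) ω j := by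
  have h1 : ∀ᵐ ω ∂P, ∀ v : s.nonzeroRange, (g v • (hZ.memLp (s.measurableSet_fiber v)
      (SimpleFunc.nonzeroRange_lt_top hs v) j).toLp : Lp ℝ 2 P) ω =
        g v * Z (s ⁻¹' {(v : V)}) ω j := by
    rw [ae_all_iff]
    intro v
    filter_upwards [Lp.coeFn_smul (g v) ((hZ.memLp (s.measurableSet_fiber v)
      (SimpleFunc.nonzeroRange_lt_top hs v) j).toLp), (hZ.memLp (s.measurableSet_fiber v)
      (SimpleFunc.nonzeroRange_lt_top hs v) j).coeFn_toLp] with ω h h'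
    rw [h, Pi.smul_apply, h', smul_eq_mul]
  rw [SimpleFunc.toLp_comp_eq_sum hs hg hm, map_sum]
  simp only [map_smul, hZ.wienerInt_indicator hQ j (s.measurableSet_fiber _)
    (SimpleFunc.nonzeroRange_lt_top hs _)]
  filter_upwards [h1, Lp.coeFn_finsetSum Finset.univ
    fun v : s.nonzeroRange => (g v • (hZ.memLp (s.measurableSet_fiber v)
      (SimpleFunc.nonzeroRange_lt_top hs v) j).toLp : Lp ℝ 2 P)] with ω h1 h2
  rw [h2, Finset.sum_apply, Finset.sum_congr rfl fun v _ => h1 v]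

lemma simpleStochInt_apply (hQ : Q.PosSemidef) (hZ : IsGaussianISRM P Q Z)
    {s : SimpleFunc (EuclideanSpace ℝ (Fin d)) (Matrix (Fin n) (Fin n) ℝ)}
    (hs : s.FinMeasSupp volume) (hm : ∀ i j, MemLp (fun y => s y i j) 2 volume) (i : Fin n) :
    (fun ω => simpleStochInt Z s ω i) =ᵐ[P] ⇑(∑ j, hZ.wienerInt j (hm i j).toLp) := by
  have h1 : ∀ᵐ ω ∂P, ∀ j, hZ.wienerInt j (hm i j).toLp ω =
      ∑ v : s.nonzeroRange, (v : Matrix (Fin n) (Fin n) ℝ) i j * Z (s ⁻¹' {(v : Matrix (Fin n) (Fin n) ℝ)}) ω j := by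
    rw [ae_all_iff]
    intro j
    exact hZ.wienerInt_simpleFunc hQ j hs (g := fun R => R i j) rfl (hm i j)
  filter_upwards [h1, Lp.coeFn_finsetSum Finset.univ fun j => hZ.wienerInt j (hm i j).toLp]
    with ω h1 h2
  rw [h2, Finset.sum_apply, Finset.sum_congr rfl fun j _ => h1 j, Finset.sum_comm, simpleStochInt,
    s.sum_range_eq_sum_nonzeroRange (fun R => Matrix.toEuclideanLin R (Z (s ⁻¹' {R}) ω)) (by simp)]
  simp [Matrix.mulVec, dotProduct]

lemma memLp_entry {s : SimpleFunc (EuclideanSpace ℝ (Fin d)) (Matrix (Fin n) (Fin n) ℝ)}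
    (hs : s.FinMeasSupp volume) (i j : Fin n) : MemLp (fun y => s y i j) 2 volume := by
  have := (SimpleFunc.memLp_iff_finMeasSupp (p := 2) (by simp) (by simp)).2
    (hs.map (g := fun R : Matrix (Fin n) (Fin n) ℝ => R i j) rfl)
  exact this

/-- The integrals of the simple approximants converge in `L²(P)` to `X i` by definition and to the
Wiener integrals by continuity; limits are unique. In particular the choice of version is
immaterial. -/
lemma _root_.IsStochInt.ae_eq (hQ : Q.PosSemidef) (hZ : IsGaussianISRM P Q Z)
    {f : EuclideanSpace ℝ (Fin d) → Matrix (Fin n) (Fin n) ℝ} {X : Ω → EuclideanSpace ℝ (Fin n)}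
    (h : IsStochInt P Z f X) (i : Fin n) :
    (fun ω => X ω i) =ᵐ[P] ⇑(∑ j, hZ.wienerInt j (h.1 i j).toLp) := by
  obtain ⟨hf, hX, s, hs, hsf, hsX⟩ := h
  have hm := fun k => memLp_entry (hs k)
  have hXi : MemLp (fun ω => X ω i) 2 P := hX.eval_piLp i
  have t1 : Tendsto (fun k => ∑ j, hZ.wienerInt j (hm k i j).toLp) atTop
      (𝓝 (∑ j, hZ.wienerInt j (hf i j).toLp)) := by
    refine tendsto_finsetSum _ fun j _ => ((hZ.wienerInt j).continuous.tendsto _).comp ?_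
    exact (Lp.tendsto_Lp_iff_tendsto_eLpNorm'' _ _ _ _).2 (hsf i j)
  have t2 : Tendsto (fun k => ∑ j, hZ.wienerInt j (hm k i j).toLp) atTop (𝓝 hXi.toLp) := by
    rw [Lp.tendsto_Lp_iff_tendsto_eLpNorm]
    refine tendsto_of_tendsto_of_tendsto_of_le_of_le tendsto_const_nhds hsX
      (fun _ => zero_le) fun k => ?_
    refine eLpNorm_mono_ae ?_
    filter_upwards [hZ.simpleStochInt_apply hQ (hs k) (hm k) i] with ω hω
    rw [Pi.sub_apply, ← hω]
    exact PiLp.norm_apply_le (simpleStochInt Z (s k) ω - X ω) i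
  rw [← tendsto_nhds_unique t2 t1]
  exact hXi.coeFn_toLp.symm

lemma exists_isStochInt (hQ : Q.PosSemidef) (hZ : IsGaussianISRM P Q Z)
    {f : EuclideanSpace ℝ (Fin d) → Matrix (Fin n) (Fin n) ℝ}
    (hf : ∀ i j, MemLp (fun y => f y i j) 2 volume) : ∃ X, IsStochInt P Z f X := by
  let X : Ω → EuclideanSpace ℝ (Fin n) := fun ω =>
    WithLp.toLp 2 fun i => (∑ j, hZ.wienerInt j (hf i j).toLp : Lp ℝ 2 P) ω
  have hX : MemLp X 2 P := MemLp.of_eval_piLp fun i => Lp.memLp _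
  -- As a nested function `f` takes values in a sup-normed space, so one simple approximation
  -- converges in all entries at once.
  let f' : EuclideanSpace ℝ (Fin d) → Fin n → Fin n → ℝ := f
  have hf' : MemLp f' 2 volume :=
    MemLp.of_eval fun i => MemLp.of_eval fun j => hf i j
  obtain ⟨s, hs, hst⟩ := hf'.exists_seq_simpleFunc_tendsto
  have hs' : ∀ k, (s k).FinMeasSupp volume := fun k =>
    (SimpleFunc.memLp_iff_finMeasSupp (p := 2) (by simp) (by simp)).1 (hs k)
  have hm := fun k => memLp_entry (hs' k)
  have hsf : ∀ i j, Tendsto (fun k => eLpNorm (fun y => s k y i j - f y i j) 2 volume)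
      atTop (𝓝 0) := fun i j => by
    refine tendsto_of_tendsto_of_tendsto_of_le_of_le tendsto_const_nhds hst
      (fun _ => zero_le) fun k => eLpNorm_mono fun y => ?_
    exact (norm_le_pi_norm ((s k y - f' y) i) j).trans
      (norm_le_pi_norm (s k y - f' y) i)
  refine ⟨X, hf, hX, s, hs', hsf, ?_⟩
  have t1 : ∀ i, Tendsto (fun k => eLpNorm (fun ω => simpleStochInt Z (s k) ω i - X ω i) 2 P) atTop
      (𝓝 0) := by
    intro i
    have t1 : Tendsto (fun k => ∑ j, hZ.wienerInt j (hm k i j).toLp) atTop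
        (𝓝 (∑ j, hZ.wienerInt j (hf i j).toLp)) := by
      refine tendsto_finsetSum _ fun j _ => ((hZ.wienerInt j).continuous.tendsto _).comp ?_
      exact (Lp.tendsto_Lp_iff_tendsto_eLpNorm'' _ _ _ _).2 (hsf i j)
    rw [Lp.tendsto_Lp_iff_tendsto_eLpNorm'] at t1
    refine t1.congr fun k => eLpNorm_congr_ae ?_
    filter_upwards [hZ.simpleStochInt_apply hQ (hs' k) (hm k) i] with ω hω
    rw [Pi.sub_apply, ← hω]
  have t2 : Tendsto (fun k => ∑ i, eLpNorm (fun ω => simpleStochInt Z (s k) ω i - X ω i) 2 P) atTop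
      (𝓝 0) := by
    simpa using tendsto_finsetSum Finset.univ fun i _ => t1 i
  refine tendsto_of_tendsto_of_tendsto_of_le_of_le tendsto_const_nhds t2 (fun _ => zero_le)
    fun k => ?_
  have hmeas : ∀ i, AEStronglyMeasurable (fun ω => simpleStochInt Z (s k) ω i - X ω i) P :=
    fun i => ((Lp.memLp _).1.congr (hZ.simpleStochInt_apply hQ (hs' k) (hm k) i).symm).sub
      (hX.eval_piLp i).1
  calc eLpNorm (fun ω => simpleStochInt Z (s k) ω - X ω) 2 P
      ≤ eLpNorm (∑ i, fun ω => ‖simpleStochInt Z (s k) ω i - X ω i‖) 2 P := by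
        refine eLpNorm_mono_real fun ω => ?_
        rw [Finset.sum_apply]
        have := EuclideanSpace.norm_eq (simpleStochInt Z (s k) ω - X ω)
        rw [this]
        refine Real.sqrt_le_iff.2 ⟨by positivity, ?_⟩
        exact Finset.sum_sq_le_sq_sum_of_nonneg fun i _ => norm_nonneg _
    _ ≤ ∑ i, eLpNorm (fun ω => ‖simpleStochInt Z (s k) ω i - X ω i‖) 2 P :=
        eLpNorm_sum_le (fun i _ => (hmeas i).norm) (by norm_num)
    _ = _ := by simp only [eLpNorm_norm]

lemma isStochInt_stochInt (hQ : Q.PosSemidef) (hZ : IsGaussianISRM P Q Z)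
    {f : EuclideanSpace ℝ (Fin d) → Matrix (Fin n) (Fin n) ℝ}
    (hf : ∀ i j, MemLp (fun y => f y i j) 2 volume) : IsStochInt P Z f (stochInt P Z f) := by
  have h := hZ.exists_isStochInt hQ hf
  rw [stochInt, dif_pos h]
  exact h.choose_spec

end IsGaussianISRM

end StochasticIntegral

/-! ### Characteristic functions of Wiener integrals -/

noncomputable section GaussianLaw

variable {Ω : Type*} [MeasurableSpace Ω] {P : Measure Ω} {d n : ℕ}
  {Q : Matrix (Fin n) (Fin n) ℝ} {Z : Set (EuclideanSpace ℝ (Fin d)) → Ω → EuclideanSpace ℝ (Fin n)}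

namespace MeasureTheory

/-- The map is 1-Lipschitz, since `|e^{ia} - e^{ib}| ≤ |a - b|` and the `L¹` norm is at most the
`L²` norm on a probability space. -/
lemma continuous_integral_cexp_Lp [IsProbabilityMeasure P] :
    Continuous fun Y : Lp ℝ 2 P => ∫ ω, Complex.exp (Y ω * Complex.I) ∂P := by
  refine LipschitzWith.continuous (K := 1) (LipschitzWith.of_dist_le_mul fun Y Y' => ?_)
  have hint : ∀ Y : Lp ℝ 2 P, Integrable (fun ω => Complex.exp (Y ω * Complex.I)) P := fun Y => by
    refine Integrable.of_bound (C := 1) ?_ (ae_of_all _ fun ω => ?_)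
    · have := (Lp.memLp Y).1
      fun_prop
    · rw [Complex.norm_exp_ofReal_mul_I]
  have hd : Integrable (fun ω => ‖Y ω - Y' ω‖) P :=
    (((Lp.memLp Y).sub (Lp.memLp Y')).integrable (by norm_num)).norm
  have hpt : ∀ a b : ℝ, ‖Complex.exp (a * Complex.I) - Complex.exp (b * Complex.I)‖ ≤ ‖a - b‖ := by
    intro a b
    have : Complex.exp (a * Complex.I) - Complex.exp (b * Complex.I) =
        Complex.exp (b * Complex.I) * (Complex.exp (Complex.I * (a - b : ℝ)) - 1) := by
      rw [mul_sub, ← Complex.exp_add, mul_one]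
      congr 2
      push_cast
      ring
    rw [this, norm_mul, Complex.norm_exp_ofReal_mul_I, one_mul]
    exact Real.norm_exp_I_mul_ofReal_sub_one_le
  rw [dist_eq_norm, ← integral_sub (hint Y) (hint Y')]
  calc ‖∫ ω, (Complex.exp (Y ω * Complex.I) - Complex.exp (Y' ω * Complex.I)) ∂P‖
      ≤ ∫ ω, ‖Y ω - Y' ω‖ ∂P :=
        norm_integral_le_of_norm_le hd (ae_of_all _ fun ω => hpt _ _)
    _ = (eLpNorm (⇑Y - ⇑Y') 1 P).toReal := by
        rw [eLpNorm_one_eq_lintegral_enorm]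
        exact integral_norm_eq_lintegral_enorm ((Lp.memLp Y).1.sub (Lp.memLp Y').1)
    _ ≤ (eLpNorm (⇑Y - ⇑Y') 2 P).toReal := by
        refine ENNReal.toReal_mono ((Lp.memLp Y).sub (Lp.memLp Y')).2.ne ?_
        exact eLpNorm_le_eLpNorm_of_exponent_le (by norm_num)
          ((Lp.memLp Y).1.sub (Lp.memLp Y').1)
    _ = (1 : NNReal) * dist Y Y' := by rw [Lp.dist_def]; simp

end MeasureTheory

namespace IsGaussianISRM

lemma iIndepFun_of_finite (hZ : IsGaussianISRM P Q Z) {ι : Type*} [Fintype ι]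
    {A : ι → Set (EuclideanSpace ℝ (Fin d))} (hA : ∀ v, MeasurableSet (A v))
    (hA' : ∀ v, volume (A v) < ⊤) (hd : Pairwise fun v w => Disjoint (A v) (A w)) :
    iIndepFun (fun v => Z (A v)) P := by
  let e : ι → ℕ := fun v => Fintype.equivFin ι v
  have he : Function.Injective e := Fin.val_injective.comp (Fintype.equivFin ι).injective
  let S : ℕ → Set (EuclideanSpace ℝ (Fin d)) := Function.extend e A fun _ => ∅
  have hS : ∀ v, S (e v) = A v := fun v => he.extend_apply _ _ v
  have hS' : ∀ k, (¬ ∃ v, e v = k) → S k = ∅ := fun k hk => Function.extend_apply' _ _ _ hk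
  have h := hZ.indep S ?_ ?_ ?_
  · have := h.precomp he
    simpa only [hS] using this
  · intro k
    by_cases hk : ∃ v, e v = k
    · obtain ⟨v, rfl⟩ := hk
      rw [hS]; exact hA v
    · rw [hS' k hk]; exact .empty
  · intro k
    by_cases hk : ∃ v, e v = k
    · obtain ⟨v, rfl⟩ := hk
      rw [hS]; exact hA' v
    · rw [hS' k hk]; simp
  · intro k l hkl
    by_cases hk : ∃ v, e v = k
    · by_cases hl : ∃ v, e v = l
      · obtain ⟨v, rfl⟩ := hk
        obtain ⟨w, rfl⟩ := hl
        rw [hS, hS]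
        exact hd fun h => hkl (by rw [h])
      · rw [hS' l hl]; simp
    · rw [hS' k hk]; simp

lemma integral_cexp_apply (hQ : Q.PosSemidef) (hZ : IsGaussianISRM P Q Z)
    {A : Set (EuclideanSpace ℝ (Fin d))} (hA : MeasurableSet A) (hA' : volume A < ⊤)
    (v : Fin n → ℝ) :
    ∫ ω, Complex.exp ((∑ j, v j * Z A ω j : ℝ) * Complex.I) ∂P =
      Complex.exp ((-(∑ i, ∑ j, Q i j * (v i * v j * volume.real A)) / 2 : ℝ)) := by
  have h := charFun_multivariateGaussian (μ := 0)
    (hQ.smul (ENNReal.toReal_nonneg (a := volume A))) (WithLp.toLp 2 v)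
  rw [← hZ.law A hA hA', charFun_apply,
    integral_map (hZ.measurable A hA hA').aemeasurable (by fun_prop)] at h
  refine Eq.trans ?_ (h.trans ?_)
  · refine integral_congr_ae (ae_of_all _ fun ω => ?_)
    simp [PiLp.inner_apply]
  · congr 1
    simp only [inner_zero_right, Complex.ofReal_zero, zero_mul, zero_sub]
    rw [neg_div, Complex.ofReal_neg, Complex.ofReal_div, Complex.ofReal_ofNat]
    congr 3
    simp only [dotProduct, Matrix.mulVec, Finset.mul_sum]
    refine Finset.sum_congr rfl fun i _ => Finset.sum_congr rfl fun j _ => ?_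
    rw [Matrix.smul_apply, smul_eq_mul, Measure.real]
    ring

variable [IsProbabilityMeasure P]

/-- The values of `Z` on the fibres of `s` are independent Gaussian vectors, so the expectation
factors over fibres. The exponents add up to the stated form because indicators of distinct fibres
are orthogonal. -/
lemma integral_cexp_wienerInt_simpleFunc (hQ : Q.PosSemidef) (hZ : IsGaussianISRM P Q Z)
    {s : SimpleFunc (EuclideanSpace ℝ (Fin d)) (Fin n → ℝ)} (hs : s.FinMeasSupp volume)
    (hm : ∀ j, MemLp (fun y => s y j) 2 volume) :
    ∫ ω, Complex.exp (((∑ j, hZ.wienerInt j (hm j).toLp : Lp ℝ 2 P) ω : ℝ) * Complex.I) ∂P =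
      Complex.exp ((-(∑ i, ∑ j, Q i j * inner ℝ (hm i).toLp (hm j).toLp) / 2 : ℝ)) := by
  have hd : Pairwise fun v w : s.nonzeroRange =>
      Disjoint (s ⁻¹' {(v : Fin n → ℝ)}) (s ⁻¹' {(w : Fin n → ℝ)}) := fun v w hvw =>
    Disjoint.preimage _ (by simpa using fun h => hvw (Subtype.ext h))
  have hmeas : ∀ v : s.nonzeroRange, MeasurableSet (s ⁻¹' {(v : Fin n → ℝ)}) :=
    fun v => s.measurableSet_fiber _
  have hfin := SimpleFunc.nonzeroRange_lt_top hs
  have hind := hZ.iIndepFun_of_finite hmeas hfin hd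
  have h1 : ∀ᵐ ω ∂P, ∀ j, hZ.wienerInt j (hm j).toLp ω =
      ∑ v : s.nonzeroRange, (v : Fin n → ℝ) j * Z (s ⁻¹' {(v : Fin n → ℝ)}) ω j := by
    rw [ae_all_iff]
    intro j
    exact hZ.wienerInt_simpleFunc hQ j hs (g := fun R => R j) rfl (hm j)
  have h2 : ∫ ω, Complex.exp (((∑ j, hZ.wienerInt j (hm j).toLp : Lp ℝ 2 P) ω : ℝ) * Complex.I) ∂P
      = ∫ ω, ∏ v : s.nonzeroRange,
        Complex.exp ((∑ j, (v : Fin n → ℝ) j * Z (s ⁻¹' {(v : Fin n → ℝ)}) ω j : ℝ) * Complex.I) ∂P := by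
    refine integral_congr_ae ?_
    filter_upwards [h1, Lp.coeFn_finsetSum Finset.univ fun j => hZ.wienerInt j (hm j).toLp]
      with ω h1 h2
    rw [h2, Finset.sum_apply, Finset.sum_congr rfl fun j _ => h1 j, Finset.sum_comm,
      ← Complex.exp_sum, Complex.ofReal_sum, Finset.sum_mul]
  have h3 := hind.integral_fun_prod_comp
    (f := fun (v : s.nonzeroRange) (x : EuclideanSpace ℝ (Fin n)) =>
      Complex.exp ((∑ j, (v : Fin n → ℝ) j * x j : ℝ) * Complex.I))
    (fun v => (hZ.measurable _ (hmeas v) (hfin v)).aemeasurable)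
    (fun v => by fun_prop)
  rw [h2, h3, Finset.prod_congr rfl fun v _ => hZ.integral_cexp_apply hQ (hmeas v) (hfin v) v,
    ← Complex.exp_sum, ← Complex.ofReal_sum]
  congr 2
  have hinner : ∀ i j, inner ℝ (hm i).toLp (hm j).toLp =
      ∑ v : s.nonzeroRange, (v : Fin n → ℝ) i * (v : Fin n → ℝ) j *
        volume.real (s ⁻¹' {(v : Fin n → ℝ)}) := by
    intro i j
    rw [SimpleFunc.toLp_comp_eq_sum hs (g := fun R => R i) rfl (hm i),
      SimpleFunc.toLp_comp_eq_sum hs (g := fun R => R j) rfl (hm j), sum_inner]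
    refine Finset.sum_congr rfl fun v _ => ?_
    rw [inner_sum, Finset.sum_eq_single v]
    · rw [real_inner_smul_left, real_inner_smul_right,
        L2.real_inner_indicatorConstLp_one_indicatorConstLp_one (hmeas v) (hmeas v) (hfin v).ne
          (hfin v).ne, Set.inter_self]
      ring
    · intro w _ hw
      rw [real_inner_smul_left, real_inner_smul_right,
        L2.real_inner_indicatorConstLp_one_indicatorConstLp_one (hmeas v) (hmeas w) (hfin v).ne
          (hfin w).ne, (hd hw.symm).inter_eq]
      simp
    · simp
  simp only [hinner, neg_div, Finset.sum_neg_distrib]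
  rw [← Finset.sum_div, Finset.sum_comm]
  congr 2
  refine Finset.sum_congr rfl fun i _ => ?_
  rw [Finset.sum_comm]
  exact Finset.sum_congr rfl fun j _ => by rw [Finset.mul_sum]

lemma integral_cexp_wienerInt (hQ : Q.PosSemidef) (hZ : IsGaussianISRM P Q Z)
    (φ : Fin n → Lp ℝ 2 (volume : Measure (EuclideanSpace ℝ (Fin d)))) :
    ∫ ω, Complex.exp (((∑ j, hZ.wienerInt j (φ j) : Lp ℝ 2 P) ω : ℝ) * Complex.I) ∂P =
      Complex.exp ((-(∑ i, ∑ j, Q i j * inner ℝ (φ i) (φ j)) / 2 : ℝ)) := by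
  -- The `φ j` are approximated jointly by vector-valued simple functions, so that their coordinates
  -- share the partition needed for independence.
  have hf : MemLp (fun y j => φ j y) 2 volume := MemLp.of_eval fun j => Lp.memLp (φ j)
  obtain ⟨s, hs, hst⟩ := hf.exists_seq_simpleFunc_tendsto
  have hs' : ∀ k, (s k).FinMeasSupp volume := fun k =>
    (SimpleFunc.memLp_iff_finMeasSupp (p := 2) (by simp) (by simp)).1 (hs k)
  have hm : ∀ k j, MemLp (fun y => s k y j) 2 volume := fun k j => (hs k).eval j
  have t : Tendsto (fun k j => (hm k j).toLp) atTop (𝓝 φ) := by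
    rw [tendsto_pi_nhds]
    intro j
    rw [Lp.tendsto_Lp_iff_tendsto_eLpNorm']
    refine tendsto_of_tendsto_of_tendsto_of_le_of_le tendsto_const_nhds hst
      (fun _ => zero_le) fun k => eLpNorm_mono_ae ?_
    filter_upwards [(hm k j).coeFn_toLp] with y hy
    rw [Pi.sub_apply, hy]
    exact norm_le_pi_norm (s k y - fun j => φ j y) j
  have c1 : Continuous fun φ : Fin n → Lp ℝ 2 (volume : Measure (EuclideanSpace ℝ (Fin d))) =>
      ∫ ω, Complex.exp (((∑ j, hZ.wienerInt j (φ j) : Lp ℝ 2 P) ω : ℝ) * Complex.I) ∂P :=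
    continuous_integral_cexp_Lp.comp (f := fun φ : Fin n → Lp ℝ 2
      (volume : Measure (EuclideanSpace ℝ (Fin d))) => ∑ j, hZ.wienerInt j (φ j)) (by fun_prop)
  have c2 : Continuous fun φ : Fin n → Lp ℝ 2 (volume : Measure (EuclideanSpace ℝ (Fin d))) =>
      Complex.exp ((-(∑ i, ∑ j, Q i j * inner ℝ (φ i) (φ j)) / 2 : ℝ)) := by fun_prop
  refine tendsto_nhds_unique ((c1.tendsto φ).comp t) (((c2.tendsto φ).comp t).congr fun k => ?_)
  exact (hZ.integral_cexp_wienerInt_simpleFunc hQ (hs' k) (hm k)).symm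

end IsGaussianISRM

end GaussianLaw

/-! ### Covariance and joint law of stochastic integrals -/

noncomputable section Covariance

variable {Ω : Type*} [MeasurableSpace Ω] {P : Measure Ω} {d n : ℕ}
  {Q : Matrix (Fin n) (Fin n) ℝ} {Z : Set (EuclideanSpace ℝ (Fin d)) → Ω → EuclideanSpace ℝ (Fin n)}

/-- The matrix `∫ f Q gᵗ`, the covariance of the stochastic integrals of `f` and `g`. -/
def kernelCov (Q : Matrix (Fin n) (Fin n) ℝ)
    (f g : EuclideanSpace ℝ (Fin d) → Matrix (Fin n) (Fin n) ℝ) : Matrix (Fin n) (Fin n) ℝ :=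
  Matrix.of fun i j => ∫ y, (f y * Q * (g y).transpose) i j

lemma mul_mul_transpose_apply (A B C : Matrix (Fin n) (Fin n) ℝ) (i j : Fin n) :
    (A * B * C.transpose) i j = ∑ k, ∑ l, B k l * (A i k * C j l) := by
  simp only [Matrix.mul_apply, Matrix.transpose_apply, Finset.sum_mul]
  rw [Finset.sum_comm]
  exact Finset.sum_congr rfl fun k _ => Finset.sum_congr rfl fun l _ => by ring

lemma integrable_kernelCov {f g : EuclideanSpace ℝ (Fin d) → Matrix (Fin n) (Fin n) ℝ}
    (hf : ∀ i j, MemLp (fun y => f y i j) 2 volume) (hg : ∀ i j, MemLp (fun y => g y i j) 2 volume)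
    (i j : Fin n) : Integrable (fun y => (f y * Q * (g y).transpose) i j) := by
  simp only [mul_mul_transpose_apply]
  exact integrable_finsetSum _ fun k _ => integrable_finsetSum _ fun l _ =>
    ((hf i k).integrable_mul (hg j l)).const_mul _

namespace IsGaussianISRM

variable [IsProbabilityMeasure P]

/-- The `i`-th coordinate of the stochastic integral of `f`, as an element of `L²(P)`. -/
def coordInt (hZ : IsGaussianISRM P Q Z) {f : EuclideanSpace ℝ (Fin d) → Matrix (Fin n) (Fin n) ℝ}
    (hf : ∀ i j, MemLp (fun y => f y i j) 2 volume) (i : Fin n) : Lp ℝ 2 P :=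
  ∑ j, hZ.wienerInt j (hf i j).toLp

lemma inner_coordInt (hQ : Q.PosSemidef) (hZ : IsGaussianISRM P Q Z)
    {f g : EuclideanSpace ℝ (Fin d) → Matrix (Fin n) (Fin n) ℝ}
    (hf : ∀ i j, MemLp (fun y => f y i j) 2 volume) (hg : ∀ i j, MemLp (fun y => g y i j) 2 volume)
    (i j : Fin n) :
    inner ℝ (hZ.coordInt hf i) (hZ.coordInt hg j) = kernelCov Q f g i j := by
  have hint : ∀ k l, Integrable (fun y => Q k l * (f y i k * g y j l)) := fun k l =>
    ((hf i k).integrable_mul (hg j l)).const_mul _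
  simp only [coordInt, sum_inner, inner_sum, hZ.inner_wienerInt hQ, kernelCov, Matrix.of_apply,
    mul_mul_transpose_apply]
  rw [Finset.sum_comm, integral_finsetSum _ fun k _ => integrable_finsetSum _ fun l _ => hint k l]
  refine Finset.sum_congr rfl fun k _ => ?_
  rw [integral_finsetSum _ fun l _ => hint k l]
  refine Finset.sum_congr rfl fun l _ => ?_
  rw [integral_const_mul, L2.inner_def]
  congr 1
  refine integral_congr_ae ?_
  filter_upwards [(hf i k).coeFn_toLp, (hg j l).coeFn_toLp] with y h1 h2
  rw [h1, h2]
  simp [mul_comm]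

lemma integral_coordInt (hQ : Q.PosSemidef) (hZ : IsGaussianISRM P Q Z)
    {f : EuclideanSpace ℝ (Fin d) → Matrix (Fin n) (Fin n) ℝ}
    (hf : ∀ i j, MemLp (fun y => f y i j) 2 volume) (i : Fin n) :
    ∫ ω, hZ.coordInt hf i ω ∂P = 0 := by
  rw [coordInt, integral_congr_ae (Lp.coeFn_finsetSum _ _)]
  simp only [Finset.sum_apply]
  rw [integral_finsetSum _ fun j _ => (Lp.memLp _).integrable (by norm_num)]
  simp [hZ.integral_wienerInt hQ]

lemma integral_mul_of_isStochInt (hQ : Q.PosSemidef) (hZ : IsGaussianISRM P Q Z)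
    {f g : EuclideanSpace ℝ (Fin d) → Matrix (Fin n) (Fin n) ℝ} {X Y : Ω → EuclideanSpace ℝ (Fin n)}
    (hX : IsStochInt P Z f X) (hY : IsStochInt P Z g Y) (i j : Fin n) :
    ∫ ω, X ω i * Y ω j ∂P = kernelCov Q f g i j := by
  rw [← hZ.inner_coordInt hQ hX.1 hY.1, L2.inner_def]
  refine integral_congr_ae ?_
  filter_upwards [hX.ae_eq hQ hZ i, hY.ae_eq hQ hZ j] with ω h1 h2
  rw [h1, h2, RCLike.inner_apply, conj_trivial, mul_comm]
  rfl

lemma secondMoment_of_isStochInt (hQ : Q.PosSemidef) (hZ : IsGaussianISRM P Q Z)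
    {f : EuclideanSpace ℝ (Fin d) → Matrix (Fin n) (Fin n) ℝ} {X : Ω → EuclideanSpace ℝ (Fin n)}
    (hX : IsStochInt P Z f X) : secondMoment P X = kernelCov Q f f := by
  ext i j
  exact hZ.integral_mul_of_isStochInt hQ hX hX i j

lemma covMatrix_of_isStochInt (hQ : Q.PosSemidef) (hZ : IsGaussianISRM P Q Z)
    {f g : EuclideanSpace ℝ (Fin d) → Matrix (Fin n) (Fin n) ℝ} {X Y : Ω → EuclideanSpace ℝ (Fin n)}
    (hX : IsStochInt P Z f X) (hY : IsStochInt P Z g Y) : covMatrix P X Y = kernelCov Q f g := by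
  ext i j
  have h0 : ∫ ω, X ω i ∂P = 0 :=
    (integral_congr_ae (hX.ae_eq hQ hZ i)).trans (hZ.integral_coordInt hQ hX.1 i)
  have h := covariance_eq_sub (hX.2.1.eval_piLp i) (hY.2.1.eval_piLp j)
  rw [h0, zero_mul, sub_zero] at h
  exact h.trans (hZ.integral_mul_of_isStochInt hQ hX hY i j)

lemma integral_cexp_sum_wienerInt (hQ : Q.PosSemidef) (hZ : IsGaussianISRM P Q Z)
    (φ : Fin n → Lp ℝ 2 (volume : Measure (EuclideanSpace ℝ (Fin d)))) :
    ∫ ω, Complex.exp (((∑ j, hZ.wienerInt j (φ j) : Lp ℝ 2 P) ω : ℝ) * Complex.I) ∂P =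
      Complex.exp ((-inner ℝ (∑ j, hZ.wienerInt j (φ j)) (∑ j, hZ.wienerInt j (φ j)) / 2 : ℝ)) := by
  rw [hZ.integral_cexp_wienerInt hQ]
  simp only [sum_inner, inner_sum, hZ.inner_wienerInt hQ]
  rw [Finset.sum_comm]

/-- A linear functional of finitely many stochastic integrals is again a sum of scalar Wiener
integrals, hence Gaussian with variance its squared `L²` norm. What matters is that the `f k` enter
the result only through `kernelCov`. -/
lemma charFunDual_of_isStochInt (hQ : Q.PosSemidef) (hZ : IsGaussianISRM P Q Z) {m : ℕ}
    {f : Fin m → EuclideanSpace ℝ (Fin d) → Matrix (Fin n) (Fin n) ℝ}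
    {X : Fin m → Ω → EuclideanSpace ℝ (Fin n)} (hX : ∀ k, IsStochInt P Z (f k) (X k))
    (L : StrongDual ℝ (Fin m → EuclideanSpace ℝ (Fin n))) :
    charFunDual (P.map fun ω k => X k ω) L =
      Complex.exp ((-(∑ k, ∑ i, ∑ l, ∑ j, L (Pi.single k (EuclideanSpace.single i 1)) *
        (L (Pi.single l (EuclideanSpace.single j 1)) * kernelCov Q (f k) (f l) i j)) / 2 : ℝ)) := by
  set c : Fin m → Fin n → ℝ := fun k i => L (Pi.single k (EuclideanSpace.single i 1)) with hc
  have hL : ∀ x, L x = ∑ k, ∑ i, c k i * x k i := by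
    intro x
    have hx : x = ∑ k, ∑ i, x k i • (Pi.single k (EuclideanSpace.single i (1 : ℝ)) :
        Fin m → EuclideanSpace ℝ (Fin n)) := by
      ext l j
      simp only [Finset.sum_apply, WithLp.ofLp_sum, Pi.smul_apply, PiLp.smul_apply, smul_eq_mul]
      rw [Finset.sum_eq_single l, Finset.sum_eq_single j]
      · simp
      · intro i _ hi
        simp [hi.symm]
      · simp
      · intro k _ hk
        simp [Pi.single_eq_of_ne hk.symm]
      · simp
    conv_lhs => rw [hx]
    simp only [map_sum, map_smul, smul_eq_mul, hc]
    exact Finset.sum_congr rfl fun k _ => Finset.sum_congr rfl fun i _ => mul_comm _ _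
  have hm : AEMeasurable (fun ω k => X k ω) P :=
    aemeasurable_pi_lambda _ fun k => (hX k).2.1.1.aemeasurable
  have hf := fun k => (hX k).1
  -- The functional is moved inside the integral: `φ` is the row vector `∑ k, (c k)ᵗ f k`.
  let φ : Fin n → Lp ℝ 2 (volume : Measure (EuclideanSpace ℝ (Fin d))) := fun j =>
    ∑ k, ∑ i, c k i • (hf k i j).toLp
  have hφ : ∑ j, hZ.wienerInt j (φ j) = ∑ k, ∑ i, c k i • hZ.coordInt (hf k) i := by
    simp only [φ, map_sum, map_smul, coordInt, Finset.smul_sum]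
    rw [Finset.sum_comm]
    exact Finset.sum_congr rfl fun k _ => Finset.sum_comm
  have hae : ∀ᵐ ω ∂P, L (fun k => X k ω) = (∑ j, hZ.wienerInt j (φ j) : Lp ℝ 2 P) ω := by
    have e1 : ∀ᵐ ω ∂P, ∀ k i, (X k ω) i = hZ.coordInt (hf k) i ω := by
      simp only [ae_all_iff]
      exact fun k i => (hX k).ae_eq hQ hZ i
    have e2 : ∀ᵐ ω ∂P, ∀ k, (∑ i, c k i • hZ.coordInt (hf k) i : Lp ℝ 2 P) ω =
        ∑ i, (c k i • hZ.coordInt (hf k) i : Lp ℝ 2 P) ω := by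
      simp only [ae_all_iff]
      intro k
      filter_upwards [Lp.coeFn_finsetSum Finset.univ fun i => c k i • hZ.coordInt (hf k) i]
        with ω h
      rw [h, Finset.sum_apply]
    have e3 : ∀ᵐ ω ∂P, ∀ k i, (c k i • hZ.coordInt (hf k) i : Lp ℝ 2 P) ω =
        c k i * hZ.coordInt (hf k) i ω := by
      simp only [ae_all_iff]
      intro k i
      filter_upwards [Lp.coeFn_smul (c k i) (hZ.coordInt (hf k) i)] with ω h
      rw [h, Pi.smul_apply, smul_eq_mul]
    rw [hφ]
    filter_upwards [e1, e2, e3, Lp.coeFn_finsetSum Finset.univ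
      fun k => ∑ i, c k i • hZ.coordInt (hf k) i] with ω h1 h2 h3 h4
    rw [h4, Finset.sum_apply, hL]
    simp only [h1, h2, h3]
  rw [charFunDual_apply, integral_map hm (by fun_prop)]
  have h5 : ∫ ω, Complex.exp (L (fun k => X k ω) * Complex.I) ∂P =
      ∫ ω, Complex.exp (((∑ j, hZ.wienerInt j (φ j) : Lp ℝ 2 P) ω : ℝ) * Complex.I) ∂P := by
    refine integral_congr_ae ?_
    filter_upwards [hae] with ω h
    rw [h]
  rw [h5, hZ.integral_cexp_sum_wienerInt hQ, hφ]
  congr 4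
  simp only [sum_inner]
  refine Finset.sum_congr rfl fun k _ => Finset.sum_congr rfl fun i _ => ?_
  simp only [inner_sum, real_inner_smul_left, real_inner_smul_right, hZ.inner_coordInt hQ]
  exact Finset.sum_congr rfl fun l _ => Finset.sum_congr rfl fun j _ => mul_left_comm _ _ _

lemma identDistrib_of_isStochInt (hQ : Q.PosSemidef) (hZ : IsGaussianISRM P Q Z) {m : ℕ}
    {f g : Fin m → EuclideanSpace ℝ (Fin d) → Matrix (Fin n) (Fin n) ℝ}
    {X Y : Fin m → Ω → EuclideanSpace ℝ (Fin n)} (hX : ∀ k, IsStochInt P Z (f k) (X k))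
    (hY : ∀ k, IsStochInt P Z (g k) (Y k))
    (h : ∀ k l, kernelCov Q (f k) (f l) = kernelCov Q (g k) (g l)) :
    IdentDistrib (fun ω k => X k ω) (fun ω k => Y k ω) P P := by
  have hmX : AEMeasurable (fun ω k => X k ω) P :=
    aemeasurable_pi_lambda _ fun k => (hX k).2.1.1.aemeasurable
  have hmY : AEMeasurable (fun ω k => Y k ω) P :=
    aemeasurable_pi_lambda _ fun k => (hY k).2.1.1.aemeasurable
  refine ⟨hmX, hmY, ?_⟩
  have := Measure.isProbabilityMeasure_map hmX
  have := Measure.isProbabilityMeasure_map hmY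
  refine Measure.ext_of_charFunDual ?_
  ext L
  rw [hZ.charFunDual_of_isStochInt hQ hX, hZ.charFunDual_of_isStochInt hQ hY]
  simp only [h]

end IsGaussianISRM

end Covariance

/-! ### Growth and decay of matrix exponentials -/

section ExponentialDecay

/-- The factor `x` covers `q = 0` without assuming `‖1‖ ≤ 1`. -/
lemma norm_mul_pow_le_mul_pow {𝔸 : Type*} [NormedRing 𝔸] (x a : 𝔸) {ρ : ℝ} (ha : ‖a‖ ≤ ρ) (q : ℕ) :
    ‖x * a ^ q‖ ≤ ‖x‖ * ρ ^ q := by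
  induction q with
  | zero => simp
  | succ q ih =>
    rw [pow_succ, ← mul_assoc, pow_succ, ← mul_assoc]
    exact (norm_mul_le _ _).trans (mul_le_mul ih ha (norm_nonneg _)
      ((norm_nonneg _).trans ih))

/-- A semigroup `t ↦ exp (t A)` whose value at time `T` has norm at most `ρ` grows at most like
`ρ ^ (t / T)`. -/
lemma exists_norm_exp_smul_le {𝔸 : Type*} [NormedRing 𝔸] [NormedAlgebra ℝ 𝔸] [CompleteSpace 𝔸]
    (A : 𝔸) {T ρ : ℝ} (hT : 0 < T) (hρ : 0 < ρ) (h : ‖NormedSpace.exp (T • A)‖ ≤ ρ) :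
    ∃ C, 0 ≤ C ∧ ∀ t, 0 ≤ t → ‖NormedSpace.exp (t • A)‖ ≤ C * Real.exp (Real.log ρ / T * t) := by
  let _ : NormedAlgebra ℚ 𝔸 := NormedAlgebra.restrictScalars ℚ ℝ 𝔸
  have hc : Continuous fun t : ℝ => NormedSpace.exp (t • A) :=
    NormedSpace.exp_continuous.comp (by fun_prop)
  obtain ⟨K, hK⟩ := (isCompact_Icc (a := (0 : ℝ)) (b := T)).exists_bound_of_continuousOn
    hc.continuousOn
  have hK0 : 0 ≤ K := (norm_nonneg _).trans (hK 0 ⟨le_rfl, hT.le⟩)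
  -- With `t = qT + s` and `0 ≤ s ≤ T`, `K` bounds the factor at time `s`, and `exp |log ρ|` pays
  -- for replacing `q` by `t / T` in the exponent.
  refine ⟨K * Real.exp |Real.log ρ|, by positivity, fun t ht => ?_⟩
  set q := ⌊t / T⌋₊ with hq
  set s := t - q * T with hs
  have hqt : (q : ℝ) * T ≤ t := (le_div_iff₀ hT).1 (Nat.floor_le (by positivity))
  have hqt' : t < (q + 1) * T := (div_lt_iff₀ hT).1 (Nat.lt_floor_add_one _)
  have hs0 : 0 ≤ s := by linarith
  have hsT : s ≤ T := by linarith
  have hexp : NormedSpace.exp (t • A) = NormedSpace.exp (s • A) * NormedSpace.exp (T • A) ^ q := by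
    have e : t • A = s • A + q • (T • A) := by
      rw [← Nat.cast_smul_eq_nsmul ℝ, smul_smul, ← add_smul, hs]; congr 1; ring
    rw [e, NormedSpace.exp_add_of_commute, NormedSpace.exp_nsmul]
    rw [← Nat.cast_smul_eq_nsmul ℝ]
    exact (((Commute.refl A).smul_left s).smul_right T).smul_right _
  rw [hexp]
  calc _ ≤ ‖NormedSpace.exp (s • A)‖ * ρ ^ q := norm_mul_pow_le_mul_pow _ _ h q
    _ ≤ K * ρ ^ q := by gcongr; exact hK s ⟨hs0, hsT⟩
    _ = K * Real.exp (Real.log ρ * q) := by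
        rw [Real.exp_mul, Real.exp_log hρ, Real.rpow_natCast]
    _ ≤ K * (Real.exp |Real.log ρ| * Real.exp (Real.log ρ / T * t)) := by
        rw [← Real.exp_add]
        gcongr
        have : Real.log ρ / T * t = Real.log ρ * q + Real.log ρ * (s / T) := by
          rw [hs]; field_simp; ring
        rw [this]
        have h1 : |Real.log ρ * (s / T)| ≤ |Real.log ρ| := by
          rw [abs_mul, abs_of_nonneg (show 0 ≤ s / T by positivity)]
          exact mul_le_of_le_one_right (abs_nonneg _) ((div_le_one hT).2 hsT)
        linarith [neg_abs_le (Real.log ρ * (s / T))]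
    _ = _ := by ring

attribute [local instance] Matrix.linftyOpNormedRing Matrix.linftyOpNormedAlgebra

variable {n : ℕ}

lemma exp_mulVec_of_mulVec_eq_smul {A : Matrix (Fin n) (Fin n) ℂ} {v : Fin n → ℂ} {z : ℂ}
    (h : A.mulVec v = z • v) : (NormedSpace.exp A).mulVec v = Complex.exp z • v := by
  have hp : ∀ k : ℕ, (A ^ k).mulVec v = z ^ k • v := fun k => by
    induction k with
    | zero => simp
    | succ k ih => rw [pow_succ, ← Matrix.mulVec_mulVec, h, Matrix.mulVec_smul, ih, smul_smul,
        pow_succ, mul_comm]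
  have h1 := NormedSpace.exp_series_hasSum_exp' (𝕂 := ℂ) A
  have h2 := h1.map ((Matrix.mulVecBilin ℂ ℂ).flip v).toAddMonoidHom (by
    change Continuous fun M : Matrix (Fin n) (Fin n) ℂ => M.mulVec v
    fun_prop)
  have h3 := (NormedSpace.exp_series_hasSum_exp' (𝕂 := ℂ) z).smul_const v
  rw [← Complex.exp_eq_exp_ℂ] at h3
  refine h2.unique ?_
  convert h3 using 1
  ext1 k
  change ((k.factorial : ℂ)⁻¹ • A ^ k).mulVec v = _
  rw [Matrix.smul_mulVec, hp, smul_smul, smul_eq_mul]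

/-- Every eigenvalue of `exp A` is the exponential of an eigenvalue of `A`. -/
lemma exists_mem_spectrum_of_mem_spectrum_exp {A : Matrix (Fin n) (Fin n) ℂ} {w : ℂ}
    (hw : w ∈ spectrum ℂ (NormedSpace.exp A)) : ∃ z ∈ spectrum ℂ A, w = Complex.exp z := by
  let f : Module.End ℂ (Fin n → ℂ) := Matrix.toLin' A
  let g : Module.End ℂ (Fin n → ℂ) := Matrix.toLin' (NormedSpace.exp A)
  have hcomm : Commute g f := by
    have hc : Commute (NormedSpace.exp A) A := (Commute.refl A).exp_left
    change g * f = f * g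
    rw [Module.End.mul_eq_comp, Module.End.mul_eq_comp, ← Matrix.toLin'_mul, ← Matrix.toLin'_mul,
      hc.eq]
  rw [← Matrix.spectrum_toLin', ← Module.End.hasEigenvalue_iff_mem_spectrum] at hw
  -- Since `A` commutes with `exp A`, it preserves this eigenspace and has an eigenvector in it;
  -- that vector is common to both matrices.
  have hmaps : Set.MapsTo f (g.eigenspace w) (g.eigenspace w) :=
    Module.End.mapsTo_genEigenspace_of_comm hcomm w 1
  have : Nontrivial (g.eigenspace w) := Submodule.nontrivial_iff_ne_bot.2 hw
  obtain ⟨z, hz⟩ := Module.End.exists_eigenvalue (f.restrict hmaps)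
  obtain ⟨v, hv⟩ := hz.exists_hasEigenvector
  have hv0 : (v : Fin n → ℂ) ≠ 0 := by simpa using hv.2
  have hfv : A.mulVec v = z • (v : Fin n → ℂ) := by
    exact congrArg Subtype.val hv.apply_eq_smul
  refine ⟨z, ?_, ?_⟩
  · rw [← Matrix.spectrum_toLin', ← Module.End.hasEigenvalue_iff_mem_spectrum]
    exact Module.End.hasEigenvalue_of_hasEigenvector (x := (v : Fin n → ℂ))
      ⟨Module.End.mem_eigenspace_iff.2 (by simpa using hfv), hv0⟩
  · have h1 : (NormedSpace.exp A).mulVec v = w • (v : Fin n → ℂ) := by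
      simpa [g] using Module.End.mem_eigenspace_iff.1 v.2
    rw [exp_mulVec_of_mulVec_eq_smul hfv] at h1
    exact (smul_left_injective ℂ hv0 h1).symm

lemma linfty_opNorm_map_algebraMap (A : Matrix (Fin n) (Fin n) ℝ) :
    ‖A.map (algebraMap ℝ ℂ)‖ = ‖A‖ := by
  simp [Matrix.linfty_opNorm_def]

lemma abs_apply_le_linfty_opNorm (A : Matrix (Fin n) (Fin n) ℝ) (i j : Fin n) :
    |A i j| ≤ ‖A‖ := by
  have h1 : ‖A i j‖₊ ≤ ∑ l, ‖A i l‖₊ :=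
    Finset.single_le_sum (f := fun l => ‖A i l‖₊) (fun _ _ => zero_le) (Finset.mem_univ j)
  have h2 : ∑ l, ‖A i l‖₊ ≤ ‖A‖₊ := by
    rw [Matrix.linfty_opNNNorm_def]
    exact Finset.le_sup (f := fun i => ∑ l, ‖A i l‖₊) (Finset.mem_univ i)
  exact_mod_cast h1.trans h2

/-- The eigenvalues of `exp(-H)` are `e^{-z}` with `Re z > 0`, so its spectral radius is below `1`,
and Gelfand's formula yields a power `k` of norm below `1`; take `T = k`. Gelfand's formula is used
over `ℂ`, and complexification preserves the norm. -/
lemma IsHurst.exists_norm_exp_lt_one {H : Matrix (Fin n) (Fin n) ℝ} (hH : IsHurst H) :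
    ∃ T : ℝ, 0 < T ∧ ‖NormedSpace.exp (T • -H)‖ < 1 := by
  set B : Matrix (Fin n) (Fin n) ℂ := (-H).map (algebraMap ℝ ℂ) with hB
  rcases isEmpty_or_nonempty (Fin n) with hn | hn
  · exact ⟨1, one_pos, by simp [Matrix.linfty_opNorm_def]⟩
  have hsr : spectralRadius ℂ (NormedSpace.exp B) < (1 : NNReal) := by
    refine spectrum.spectralRadius_lt_of_forall_lt _ fun w hw => ?_
    obtain ⟨z, hz, rfl⟩ := exists_mem_spectrum_of_mem_spectrum_exp hw
    have hz' : -z ∈ spectrum ℂ (H.map (algebraMap ℝ ℂ)) := by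
      have : B = -(H.map (algebraMap ℝ ℂ)) := by ext; simp [hB]
      rw [this, ← spectrum.neg_eq] at hz
      simpa using hz
    have := hH _ hz'
    rw [← NNReal.coe_lt_coe, coe_nnnorm, Complex.norm_exp, NNReal.coe_one, Real.exp_lt_one_iff]
    simpa using this
  have hG := spectrum.pow_nnnorm_pow_one_div_tendsto_nhds_spectralRadius (NormedSpace.exp B)
  obtain ⟨k, hk, hk0⟩ := ((hG.eventually_lt_const hsr).and (eventually_gt_atTop 0)).exists
  refine ⟨k, by exact_mod_cast hk0, ?_⟩
  have hlt : ‖NormedSpace.exp B ^ k‖₊ < 1 := by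
    by_contra hge
    push Not at hge
    refine absurd hk (not_lt.2 ?_)
    have := ENNReal.rpow_le_rpow (z := 1 / (k : ℝ)) (ENNReal.coe_le_coe.2 hge) (by positivity)
    simpa using this
  have hmap : NormedSpace.exp B ^ k =
      (NormedSpace.exp ((k : ℝ) • -H)).map (algebraMap ℝ ℂ) := by
    have h1 := NormedSpace.map_exp (algebraMap ℝ ℂ).mapMatrix
      (by change Continuous fun M : Matrix (Fin n) (Fin n) ℝ => M.map (algebraMap ℝ ℂ)
          exact continuous_id.matrix_map (continuous_algebraMap ℝ ℂ)) (-H)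
    rw [Nat.cast_smul_eq_nsmul, Matrix.exp_nsmul]
    change _ = (algebraMap ℝ ℂ).mapMatrix _
    rw [map_pow]
    exact congrArg (· ^ k) h1.symm
  rw [← linfty_opNorm_map_algebraMap, ← hmap]
  exact_mod_cast hlt

/-- Power bounds for the entries of `r ^ H`. -/
lemma IsHurst.exists_abs_matPow_le {H : Matrix (Fin n) (Fin n) ℝ} (hH : IsHurst H) :
    ∃ a b C : ℝ, 0 < a ∧ 0 < b ∧ 0 ≤ C ∧
      ∀ r, 0 < r → ∀ i j, |matPow r H i j| ≤ C * (r ^ a + r ^ b) := by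
  obtain ⟨T, hT, hlt⟩ := hH.exists_norm_exp_lt_one
  -- The maximum keeps `ρ` positive, so that `log ρ < 0`; likewise the `2` in `σ` below makes `log σ
  -- > 0`.
  set ρ := max ‖NormedSpace.exp (T • -H)‖ (1 / 2) with hρ
  have hρ0 : 0 < ρ := by positivity
  have hρ1 : ρ < 1 := max_lt hlt (by norm_num)
  obtain ⟨C₁, hC₁, h₁⟩ := exists_norm_exp_smul_le (-H) hT hρ0 (le_max_left _ _)
  set σ := max ‖NormedSpace.exp ((1 : ℝ) • H)‖ 2 with hσ
  have hσ1 : 1 < σ := lt_of_lt_of_le (by norm_num) (le_max_right _ _)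
  obtain ⟨C₂, hC₂, h₂⟩ := exists_norm_exp_smul_le H one_pos (ρ := σ) (by linarith) (le_max_left _ 2)
  refine ⟨-(Real.log ρ / T), Real.log σ, C₁ + C₂, ?_, Real.log_pos hσ1, by positivity, ?_⟩
  · rw [neg_pos]
    exact div_neg_of_neg_of_pos (Real.log_neg hρ0 hρ1) hT
  · intro r hr i j
    refine (abs_apply_le_linfty_opNorm _ i j).trans ?_
    rw [matPow, if_pos hr, Real.rpow_def_of_pos hr, Real.rpow_def_of_pos hr]
    -- For `r ≤ 1`, `r^H` is the decaying semigroup of `-H` at time `-log r`; for `r ≥ 1` any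
    -- exponential bound on the semigroup of `H` suffices.
    rcases le_total r 1 with h | h
    · have hl := Real.log_nonpos hr.le h
      have := h₁ (-Real.log r) (by linarith)
      rw [smul_neg, neg_smul, neg_neg] at this
      refine this.trans ?_
      have e : Real.log ρ / T * -Real.log r = Real.log r * -(Real.log ρ / T) := by ring
      rw [e]
      have p1 := Real.exp_pos (Real.log r * -(Real.log ρ / T))
      have p2 := Real.exp_pos (Real.log r * Real.log σ)
      nlinarith [mul_nonneg hC₁ p2.le, mul_nonneg hC₂ p1.le, mul_nonneg hC₂ p2.le]
    · have hl := Real.log_nonneg h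
      refine (h₂ (Real.log r) hl).trans ?_
      rw [div_one, mul_comm (Real.log σ)]
      have p1 := Real.exp_pos (Real.log r * -(Real.log ρ / T))
      have p2 := Real.exp_pos (Real.log r * Real.log σ)
      nlinarith [mul_nonneg hC₁ p2.le, mul_nonneg hC₁ p1.le, mul_nonneg hC₂ p1.le]

end ExponentialDecay

/-! ### Scaling and square integrability of the tempered kernel -/

noncomputable section TemperedKernel

variable {d n : ℕ} {Q H : Matrix (Fin n) (Fin n) ℝ}

section MatPow

lemma matPow_zero (A : Matrix (Fin n) (Fin n) ℝ) : matPow 0 A = 0 := by simp [matPow]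

lemma matPow_transpose (r : ℝ) (A : Matrix (Fin n) (Fin n) ℝ) :
    matPow r A.transpose = (matPow r A).transpose := by
  unfold matPow
  split_ifs
  · rw [← Matrix.transpose_smul, Matrix.exp_transpose]
  · simp

lemma matPow_mul_base {r s : ℝ} (hr : 0 < r) (hs : 0 < s) (A : Matrix (Fin n) (Fin n) ℝ) :
    matPow (r * s) A = matPow r A * matPow s A := by
  rw [matPow, matPow, matPow, if_pos hr, if_pos hs, if_pos (mul_pos hr hs),
    Real.log_mul hr.ne' hs.ne', add_smul, Matrix.exp_add_of_commute]
  exact ((Commute.refl A).smul_left _).smul_right _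

lemma matPow_sub_smul_one {r : ℝ} (hr : 0 < r) (A : Matrix (Fin n) (Fin n) ℝ) (c : ℝ) :
    matPow r (A - c • 1) = r ^ (-c) • matPow r A := by
  have e : Real.log r • (A - c • (1 : Matrix (Fin n) (Fin n) ℝ)) =
      Real.log r • A + (Real.log r * -c) • (1 : Matrix (Fin n) (Fin n) ℝ) := by
    rw [smul_sub, smul_smul, mul_neg, neg_smul, sub_eq_add_neg]
  have h1 : NormedSpace.exp ((Real.log r * -c) • (1 : Matrix (Fin n) (Fin n) ℝ)) =
      Real.exp (Real.log r * -c) • 1 := by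
    rw [Matrix.smul_one_eq_diagonal, Matrix.exp_diagonal, Matrix.smul_one_eq_diagonal]
    congr 1
    ext i
    rw [Pi.coe_exp, Real.exp_eq_exp_ℝ]
  rw [matPow, matPow, if_pos hr, if_pos hr, e, Matrix.exp_add_of_commute, h1,
    Real.rpow_def_of_pos hr, mul_smul_comm, mul_one]
  exact (Commute.one_right _).smul_right _

lemma measurable_matPow_apply (A : Matrix (Fin n) (Fin n) ℝ) (i j : Fin n) :
    Measurable fun r => matPow r A i j := by
  have hc : Continuous fun t : ℝ => NormedSpace.exp (t • A) i j := by
    have : Continuous fun t : ℝ => NormedSpace.exp (t • A) := by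
      open scoped Matrix.Norms.Operator in
      exact NormedSpace.exp_continuous.comp (by fun_prop)
    exact this.matrix_elem i j
  have : (fun r => matPow r A i j) =
      fun r => if 0 < r then NormedSpace.exp (Real.log r • A) i j else 0 := by
    ext r
    rw [matPow]
    split_ifs <;> rfl
  rw [this]
  exact Measurable.ite measurableSet_Ioi (hc.measurable.comp Real.measurable_log) measurable_const

end MatPow

/-- The tempered power kernel `z ↦ e^{-lam ‖z‖} ‖z‖^{H - (d/2) I}`. -/
def temperedPow (H : Matrix (Fin n) (Fin n) ℝ) (lam : ℝ) (z : EuclideanSpace ℝ (Fin d)) :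
    Matrix (Fin n) (Fin n) ℝ :=
  Real.exp (-lam * ‖z‖) • matPow ‖z‖ (H - ((d : ℝ) / 2) • 1)

lemma itofbfKernel_eq (H : Matrix (Fin n) (Fin n) ℝ) (lam : ℝ) (x : EuclideanSpace ℝ (Fin d)) :
    itofbfKernel H lam x = fun y => temperedPow H lam (x - y) - temperedPow H lam (-y) := rfl

lemma temperedPow_of_norm_eq {lam : ℝ} {z w : EuclideanSpace ℝ (Fin d)} (h : ‖z‖ = ‖w‖) :
    temperedPow H lam z = temperedPow H lam w := by
  rw [temperedPow, temperedPow, h]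

/-- Tempering breaks self-similarity: a dilation also rescales `lam`. This is the origin of the
parameter `‖x‖ lam` in `radialC2`. -/
lemma temperedPow_smul {lam r : ℝ} (hr : 0 < r) (z : EuclideanSpace ℝ (Fin d)) :
    temperedPow H lam (r • z) =
      r ^ (-((d : ℝ) / 2)) • (matPow r H * temperedPow H (r * lam) z) := by
  have hn : ‖r • z‖ = r * ‖z‖ := by rw [norm_smul, Real.norm_of_nonneg hr.le]
  rw [temperedPow, temperedPow, hn]
  rcases (norm_nonneg z).eq_or_lt with h | h
  · rw [← h, mul_zero, matPow_zero]; simp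
  · rw [matPow_mul_base hr h, matPow_sub_smul_one hr, Matrix.smul_mul, Matrix.mul_smul, smul_smul,
      smul_smul, mul_comm]
    congr 3
    ring

/-- In polar coordinates the Jacobian `r^{d-1}` meets the factor `r^{-d}` of the squared kernel,
leaving multiples of `r^{2a-1} e^{-2 lam r}` and the same with `b`: integrable at `0` as `a, b > 0`,
at infinity as `lam > 0`. -/
lemma memLp_temperedPow [NeZero d] (hH : IsHurst H) {lam : ℝ} (hlam : 0 < lam) (i j : Fin n) :
    MemLp (fun z : EuclideanSpace ℝ (Fin d) => temperedPow H lam z i j) 2 volume := by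
  obtain ⟨a, b, C, ha, hb, hC, hbound⟩ := hH.exists_abs_matPow_le
  have hmeas : Measurable fun z : EuclideanSpace ℝ (Fin d) => temperedPow H lam z i j := by
    have := (measurable_matPow_apply (H - ((d : ℝ) / 2) • 1) i j).comp
      (measurable_norm (α := EuclideanSpace ℝ (Fin d)))
    have h2 : Measurable fun z : EuclideanSpace ℝ (Fin d) => Real.exp (-lam * ‖z‖) := by fun_prop
    exact h2.mul this
  rw [memLp_two_iff_integrable_sq hmeas.aestronglyMeasurable]
  let h : ℝ → ℝ := fun r => 2 * C ^ 2 * ((r ^ (2 * a - d) + r ^ (2 * b - d)) *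
    Real.exp (-(2 * lam) * r ^ (1 : ℝ)))
  have hint : Integrable (fun z : EuclideanSpace ℝ (Fin d) => h ‖z‖) := by
    have : Nontrivial (EuclideanSpace ℝ (Fin d)) := inferInstance
    rw [integrable_fun_norm_addHaar volume (f := h)]
    have i1 := integrableOn_rpow_mul_exp_neg_mul_rpow (p := 1) (s := 2 * a - 1) (b := 2 * lam)
      (by linarith) one_pos (by linarith)
    have i2 := integrableOn_rpow_mul_exp_neg_mul_rpow (p := 1) (s := 2 * b - 1) (b := 2 * lam)
      (by linarith) one_pos (by linarith)
    refine IntegrableOn.congr_fun ((i1.add i2).const_mul (2 * C ^ 2)) (fun r hr => ?_)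
      measurableSet_Ioi
    have hr' : 0 < r := hr
    have hd : 1 ≤ d := NeZero.one_le
    have hp : ∀ c : ℝ, r ^ (2 * c - 1) = r ^ (d - 1) * r ^ (2 * c - d) := by
      intro c
      rw [← Real.rpow_natCast, ← Real.rpow_add hr', Nat.cast_sub hd]
      congr 1
      push_cast
      ring
    simp only [Pi.add_apply, finrank_euclideanSpace, Fintype.card_fin, smul_eq_mul, h, hp]
    ring
  refine hint.mono' (hmeas.pow_const 2).aestronglyMeasurable (ae_of_all _ fun z => ?_)
  rw [Real.norm_of_nonneg (sq_nonneg _)]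
  have hh : temperedPow H lam z i j =
      Real.exp (-lam * ‖z‖) * matPow ‖z‖ (H - ((d : ℝ) / 2) • 1) i j := rfl
  rcases (norm_nonneg z).eq_or_lt with hz | hz
  · rw [hh, ← hz, matPow_zero]
    have h0 : 0 ≤ h 0 := by dsimp only [h]; positivity
    simpa using h0
  · set r := ‖z‖
    have hb' := hbound r hz i j
    rw [hh, matPow_sub_smul_one hz, Matrix.smul_apply, smul_eq_mul]
    have hsq : matPow r H i j ^ 2 ≤ 2 * C ^ 2 * ((r ^ a) ^ 2 + (r ^ b) ^ 2) := by
      rw [← sq_abs]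
      calc |matPow r H i j| ^ 2 ≤ (C * (r ^ a + r ^ b)) ^ 2 := by gcongr
        _ ≤ _ := by nlinarith [mul_nonneg (sq_nonneg C) (sq_nonneg (r ^ a - r ^ b))]
    have e1 : Real.exp (-lam * r) ^ 2 = Real.exp (-(2 * lam) * r ^ (1 : ℝ)) := by
      rw [← Real.exp_nat_mul, Real.rpow_one]; congr 1; push_cast; ring
    have e2 : ∀ c : ℝ, (r ^ (-((d : ℝ) / 2))) ^ 2 * (r ^ c) ^ 2 = r ^ (2 * c - d) := by
      intro c
      rw [← mul_pow, ← Real.rpow_add hz, ← Real.rpow_natCast, ← Real.rpow_mul hz.le]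
      congr 1
      push_cast
      ring
    calc (Real.exp (-lam * r) * (r ^ (-((d : ℝ) / 2)) * matPow r H i j)) ^ 2
        = Real.exp (-lam * r) ^ 2 * ((r ^ (-((d : ℝ) / 2))) ^ 2 * matPow r H i j ^ 2) := by ring
      _ ≤ Real.exp (-lam * r) ^ 2 * ((r ^ (-((d : ℝ) / 2))) ^ 2 *
          (2 * C ^ 2 * ((r ^ a) ^ 2 + (r ^ b) ^ 2))) := by gcongr
      _ = 2 * C ^ 2 * (((r ^ (-((d : ℝ) / 2))) ^ 2 * (r ^ a) ^ 2 +
          (r ^ (-((d : ℝ) / 2))) ^ 2 * (r ^ b) ^ 2) * Real.exp (-lam * r) ^ 2) := by ring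
      _ = h r := by rw [e1, e2, e2]

/-- The translated and reflected kernel `y ↦ K(x - y)` is square integrable. -/
lemma memLp_temperedPow_sub [NeZero d] (hH : IsHurst H) {lam : ℝ} (hlam : 0 < lam)
    (x : EuclideanSpace ℝ (Fin d)) (i j : Fin n) :
    MemLp (fun y => temperedPow H lam (x - y) i j) 2 volume :=
  (memLp_temperedPow hH hlam i j).comp_measurePreserving
    (Measure.measurePreserving_sub_left volume x)

lemma memLp_itofbfKernel [NeZero d] (hH : IsHurst H) {lam : ℝ} (hlam : 0 < lam)
    (x : EuclideanSpace ℝ (Fin d)) (i j : Fin n) :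
    MemLp (fun y => itofbfKernel H lam x y i j) 2 volume := by
  have := (memLp_temperedPow_sub hH hlam x i j).sub (memLp_temperedPow_sub hH hlam 0 i j)
  simpa [itofbfKernel_eq, Pi.sub_def] using this

end TemperedKernel

/-! ### Symmetries of the kernel covariance -/

noncomputable section KernelCovariance

variable {d n : ℕ} {Q H : Matrix (Fin n) (Fin n) ℝ}

section KernelCov

variable {f g h : EuclideanSpace ℝ (Fin d) → Matrix (Fin n) (Fin n) ℝ}

lemma kernelCov_sub_left (hf : ∀ i j, MemLp (fun y => f y i j) 2 volume)
    (hg : ∀ i j, MemLp (fun y => g y i j) 2 volume)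
    (hh : ∀ i j, MemLp (fun y => h y i j) 2 volume) :
    kernelCov Q (fun y => f y - g y) h = kernelCov Q f h - kernelCov Q g h := by
  ext i j
  have := integral_sub (integrable_kernelCov (Q := Q) hf hh i j)
    (integrable_kernelCov (Q := Q) hg hh i j)
  simp only [kernelCov, Matrix.of_apply, Matrix.sub_apply, Matrix.sub_mul]
  exact this

lemma kernelCov_transpose (hQ : Q.PosSemidef) :
    (kernelCov Q f g).transpose = kernelCov Q g f := by
  have hQt : Q.transpose = Q := by simpa using hQ.1.eq
  ext i j
  simp only [kernelCov, Matrix.of_apply, Matrix.transpose_apply]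
  congr 1
  ext y
  have : (f y * Q * (g y).transpose).transpose = g y * Q * (f y).transpose := by
    rw [Matrix.transpose_mul, Matrix.transpose_mul, Matrix.transpose_transpose, hQt,
      Matrix.mul_assoc]
  rw [← this, Matrix.transpose_apply]

lemma kernelCov_sub_right (hQ : Q.PosSemidef) (hf : ∀ i j, MemLp (fun y => f y i j) 2 volume)
    (hg : ∀ i j, MemLp (fun y => g y i j) 2 volume)
    (hh : ∀ i j, MemLp (fun y => h y i j) 2 volume) :
    kernelCov Q f (fun y => g y - h y) = kernelCov Q f g - kernelCov Q f h := by
  rw [← kernelCov_transpose hQ, kernelCov_sub_left hg hh hf, Matrix.transpose_sub,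
    kernelCov_transpose hQ, kernelCov_transpose hQ]

lemma kernelCov_comp_sub_left (a : EuclideanSpace ℝ (Fin d)) :
    kernelCov Q (fun y => f (a - y)) (fun y => g (a - y)) = kernelCov Q f g := by
  ext i j
  exact integral_sub_left_eq_self (fun y => (f y * Q * (g y).transpose) i j) volume a

lemma kernelCov_comp_isometry (U : EuclideanSpace ℝ (Fin d) ≃ₗᵢ[ℝ] EuclideanSpace ℝ (Fin d)) :
    kernelCov Q (fun y => f (U y)) (fun y => g (U y)) = kernelCov Q f g := by
  ext i j
  exact U.measurePreserving.integral_comp U.toHomeomorph.measurableEmbedding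
    (fun y => (f y * Q * (g y).transpose) i j)

lemma kernelCov_comp_smul {r : ℝ} (hr : 0 < r) :
    kernelCov Q (fun y => f (r • y)) (fun y => g (r • y)) = r ^ (-(d : ℝ)) • kernelCov Q f g := by
  ext i j
  have := Measure.integral_comp_smul volume (fun y => (f y * Q * (g y).transpose) i j) r
  rw [finrank_euclideanSpace, Fintype.card_fin, abs_of_pos (by positivity)] at this
  rw [Real.rpow_neg hr.le, Real.rpow_natCast]
  exact this

lemma kernelCov_smul_mul (hf : ∀ i j, MemLp (fun y => f y i j) 2 volume)
    (hg : ∀ i j, MemLp (fun y => g y i j) 2 volume) (c : ℝ) (M : Matrix (Fin n) (Fin n) ℝ) :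
    kernelCov Q (fun y => c • (M * f y)) (fun y => c • (M * g y)) =
      c ^ 2 • (M * kernelCov Q f g * M.transpose) := by
  ext i j
  have hint : ∀ k l, Integrable fun y => (f y * Q * (g y).transpose) k l :=
    integrable_kernelCov hf hg
  have e : ∀ y, (c • (M * f y) * Q * (c • (M * g y)).transpose) i j =
      c ^ 2 * ∑ k, ∑ l, M j k * (M i l * (f y * Q * (g y).transpose) l k) := by
    intro y
    have : c • (M * f y) * Q * (c • (M * g y)).transpose =
        c ^ 2 • (M * (f y * Q * (g y).transpose) * M.transpose) := by
      rw [Matrix.transpose_smul, Matrix.transpose_mul, Matrix.mul_smul, Matrix.smul_mul,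
        Matrix.smul_mul, smul_smul, sq]
      simp only [Matrix.mul_assoc]
    rw [this, Matrix.smul_apply, smul_eq_mul, Matrix.mul_apply]
    congr 1
    refine Finset.sum_congr rfl fun k _ => ?_
    rw [Matrix.mul_apply, Matrix.transpose_apply, Finset.sum_mul]
    exact Finset.sum_congr rfl fun l _ => mul_comm _ _
  rw [Matrix.smul_apply, smul_eq_mul, Matrix.mul_apply]
  simp only [kernelCov, Matrix.of_apply, e]
  rw [integral_const_mul, integral_finsetSum _ fun k _ => integrable_finsetSum _ fun l _ =>
    ((hint l k).const_mul _).const_mul _]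
  congr 1
  refine Finset.sum_congr rfl fun k _ => ?_
  rw [integral_finsetSum _ fun l _ => ((hint l k).const_mul _).const_mul _, Matrix.mul_apply,
    Matrix.transpose_apply, Finset.sum_mul]
  refine Finset.sum_congr rfl fun l _ => ?_
  rw [integral_const_mul, integral_const_mul, mul_comm]
  rfl

end KernelCov

lemma itofbfKernel_isometry (lam : ℝ) (U : EuclideanSpace ℝ (Fin d) ≃ₗᵢ[ℝ] EuclideanSpace ℝ (Fin d))
    (x y : EuclideanSpace ℝ (Fin d)) :
    itofbfKernel H lam (U x) (U y) = itofbfKernel H lam x y := by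
  simp only [itofbfKernel_eq]
  rw [temperedPow_of_norm_eq (z := U x - U y) (w := x - y) (by rw [← map_sub, U.norm_map]),
    temperedPow_of_norm_eq (z := -U y) (w := -y) (by rw [norm_neg, norm_neg, U.norm_map])]

lemma kernelCov_itofbfKernel_isometry (lam : ℝ)
    (U : EuclideanSpace ℝ (Fin d) ≃ₗᵢ[ℝ] EuclideanSpace ℝ (Fin d))
    (x x' : EuclideanSpace ℝ (Fin d)) :
    kernelCov Q (itofbfKernel H lam (U x)) (itofbfKernel H lam (U x')) =
      kernelCov Q (itofbfKernel H lam x) (itofbfKernel H lam x') := by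
  rw [← kernelCov_comp_isometry U]
  simp only [itofbfKernel_isometry]

lemma itofbfKernel_smul (lam : ℝ) {r : ℝ} (hr : 0 < r) (x y : EuclideanSpace ℝ (Fin d)) :
    itofbfKernel H lam (r • x) (r • y) =
      r ^ (-((d : ℝ) / 2)) • (matPow r H * itofbfKernel H (r * lam) x y) := by
  simp only [itofbfKernel_eq]
  rw [← smul_sub, ← smul_neg, temperedPow_smul hr, temperedPow_smul hr, Matrix.mul_sub, smul_sub]

lemma kernelCov_itofbfKernel_smul [NeZero d] (hH : IsHurst H) {lam : ℝ} (hlam : 0 < lam) {r : ℝ} (hr : 0 < r)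
    (x : EuclideanSpace ℝ (Fin d)) :
    kernelCov Q (itofbfKernel H lam (r • x)) (itofbfKernel H lam (r • x)) =
      matPow r H * kernelCov Q (itofbfKernel H (r * lam) x) (itofbfKernel H (r * lam) x) *
        matPow r H.transpose := by
  have hK := memLp_itofbfKernel hH (mul_pos hr hlam) x
  have h1 := kernelCov_comp_smul (Q := Q) (f := itofbfKernel H lam (r • x))
    (g := itofbfKernel H lam (r • x)) hr
  simp only [itofbfKernel_smul lam hr] at h1
  rw [kernelCov_smul_mul hK hK] at h1
  have e : (r ^ (-((d : ℝ) / 2))) ^ 2 = r ^ (-(d : ℝ)) := by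
    rw [← Real.rpow_natCast, ← Real.rpow_mul hr.le]
    congr 1
    push_cast
    ring
  rw [e] at h1
  rw [matPow_transpose]
  exact (smul_right_injective _ (Real.rpow_pos_of_pos hr _).ne' h1).symm

/-- The substitution `y ↦ a + b - y` turns `a - y` into `-(b - y)` and vice versa, and a radial
function ignores the sign. For general `f`, `g` a swap would transpose the matrix. -/
lemma kernelCov_temperedPow_symm (lam : ℝ) (a b : EuclideanSpace ℝ (Fin d)) :
    kernelCov Q (fun y => temperedPow H lam (a - y)) (fun y => temperedPow H lam (b - y)) =
      kernelCov Q (fun y => temperedPow H lam (b - y)) (fun y => temperedPow H lam (a - y)) := by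
  rw [← kernelCov_comp_sub_left (a + b)]
  congr 1 <;> ext1 y <;> refine temperedPow_of_norm_eq ?_
  · rw [← norm_neg]; congr 1; abel
  · rw [← norm_neg]; congr 1; abel

lemma kernelCov_itofbfKernel_symm [NeZero d] (hQ : Q.PosSemidef) (hH : IsHurst H) {lam : ℝ} (hlam : 0 < lam)
    (x x' : EuclideanSpace ℝ (Fin d)) :
    kernelCov Q (itofbfKernel H lam x) (itofbfKernel H lam x') =
      kernelCov Q (itofbfKernel H lam x') (itofbfKernel H lam x) := by
  have hK : ∀ x i j, MemLp (fun y : EuclideanSpace ℝ (Fin d) => temperedPow H lam (x - y) i j) 2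
    volume := memLp_temperedPow_sub hH hlam
  have hF : ∀ x i j, MemLp (fun y : EuclideanSpace ℝ (Fin d) =>
    (temperedPow H lam (x - y) - temperedPow H lam (0 - y)) i j) 2 volume :=
    fun x i j => (hK x i j).sub (hK 0 i j)
  have e : ∀ x : EuclideanSpace ℝ (Fin d), itofbfKernel H lam x = fun y =>
      temperedPow H lam (x - y) - temperedPow H lam (0 - y) := fun x => by
    simp only [itofbfKernel_eq, zero_sub]
  have expand : ∀ x x' : EuclideanSpace ℝ (Fin d),
      kernelCov Q (itofbfKernel H lam x) (itofbfKernel H lam x') =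
      kernelCov Q (fun y => temperedPow H lam (x - y)) (fun y => temperedPow H lam (x' - y)) -
      kernelCov Q (fun y => temperedPow H lam (x - y)) (fun y => temperedPow H lam (0 - y)) -
      (kernelCov Q (fun y => temperedPow H lam (0 - y)) (fun y => temperedPow H lam (x' - y)) -
      kernelCov Q (fun y : EuclideanSpace ℝ (Fin d) => temperedPow H lam (0 - y))
        (fun y => temperedPow H lam (0 - y))) := by
    intro x x'
    rw [e x, e x', kernelCov_sub_left (hK x) (hK 0) (hF x'), kernelCov_sub_right hQ (hK x) (hK x')
      (hK 0), kernelCov_sub_right hQ (hK 0) (hK x') (hK 0)]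
  rw [expand x x', expand x' x, kernelCov_temperedPow_symm lam x' x,
    kernelCov_temperedPow_symm lam x' 0, kernelCov_temperedPow_symm lam x 0]
  abel

/-- Stationarity of the increments. -/
lemma kernelCov_itofbfKernel_sub (lam : ℝ) (x x' : EuclideanSpace ℝ (Fin d)) :
    kernelCov Q (fun y => itofbfKernel H lam x y - itofbfKernel H lam x' y)
      (fun y => itofbfKernel H lam x y - itofbfKernel H lam x' y) =
    kernelCov Q (itofbfKernel H lam (x - x')) (itofbfKernel H lam (x - x')) := by
  have e : (fun y => itofbfKernel H lam x y - itofbfKernel H lam x' y) =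
      fun y => temperedPow H lam (x - y) - temperedPow H lam (x' - y) := by
    ext1 y
    simp only [itofbfKernel_eq, sub_sub_sub_cancel_right]
  -- Reflecting one side by `y ↦ x' - y` and the other by `y ↦ -y` brings both to the kernel `K(x -
  -- x' + y) - K(y)`.
  rw [e, ← kernelCov_comp_sub_left (f := itofbfKernel H lam (x - x')) 0,
    ← kernelCov_comp_sub_left x']
  congr 1 <;> ext1 y <;> simp only [itofbfKernel_eq] <;> congr 2 <;> abel

end KernelCovariance

/-! ### Covariance and isotropy of the field -/

section Field

variable {Ω : Type*} [MeasurableSpace Ω] {P : Measure Ω} {d n : ℕ}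
  {Q H : Matrix (Fin n) (Fin n) ℝ} {Z : Set (EuclideanSpace ℝ (Fin d)) → Ω → EuclideanSpace ℝ (Fin n)}

lemma kernelCov_itofbfKernel_polarization [NeZero d] (hQ : Q.PosSemidef) (hH : IsHurst H) {lam : ℝ}
    (hlam : 0 < lam) (x x' : EuclideanSpace ℝ (Fin d)) :
    kernelCov Q (itofbfKernel H lam x) (itofbfKernel H lam x') = (1 / 2 : ℝ) •
      (kernelCov Q (itofbfKernel H lam x) (itofbfKernel H lam x) +
        kernelCov Q (itofbfKernel H lam x') (itofbfKernel H lam x') -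
        kernelCov Q (itofbfKernel H lam (x - x')) (itofbfKernel H lam (x - x'))) := by
  have hK := memLp_itofbfKernel hH hlam (d := d)
  have hF : ∀ i j, MemLp (fun y => (itofbfKernel H lam x y - itofbfKernel H lam x' y) i j) 2
    volume := fun i j => (hK x i j).sub (hK x' i j)
  rw [← kernelCov_itofbfKernel_sub, kernelCov_sub_left (hK x) (hK x') hF,
    kernelCov_sub_right hQ (hK x) (hK x) (hK x'), kernelCov_sub_right hQ (hK x') (hK x) (hK x'),
    kernelCov_itofbfKernel_symm hQ hH hlam x' x]
  module

/-- The reflection in the hyperplane orthogonal to `v - w` does it. -/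
lemma exists_linearIsometryEquiv_apply_eq {E : Type*} [NormedAddCommGroup E] [InnerProductSpace ℝ E]
    {v w : E} (h : ‖v‖ = ‖w‖) : ∃ U : E ≃ₗᵢ[ℝ] E, U v = w :=
  ⟨_, Submodule.reflection_sub h⟩

lemma exists_linearIsometryEquiv_of_mem_orthogonalGroup {O : Matrix (Fin d) (Fin d) ℝ}
    (hO : O ∈ Matrix.orthogonalGroup (Fin d) ℝ) :
    ∃ U : EuclideanSpace ℝ (Fin d) ≃ₗᵢ[ℝ] EuclideanSpace ℝ (Fin d),
      ∀ x, U x = Matrix.toEuclideanLin O x := by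
  have hnorm : ∀ x, ‖Matrix.toEuclideanLin O x‖ = ‖x‖ := by
    intro x
    rw [← sq_eq_sq₀ (norm_nonneg _) (norm_nonneg _), ← real_inner_self_eq_norm_sq,
      ← real_inner_self_eq_norm_sq, EuclideanSpace.inner_eq_star_dotProduct,
      EuclideanSpace.inner_eq_star_dotProduct, Matrix.ofLp_toLpLin, Matrix.toLin'_apply, star_trivial,
      star_trivial, Matrix.dotProduct_mulVec, Matrix.vecMul_mulVec,
      (Matrix.mem_orthogonalGroup_iff' _ _).1 hO, Matrix.vecMul_one]
  exact ⟨LinearIsometry.toLinearIsometryEquiv ⟨Matrix.toEuclideanLin O, hnorm⟩ rfl, fun x => rfl⟩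

lemma secondMoment_posSemidef {X : Ω → EuclideanSpace ℝ (Fin n)} (hX : MemLp X 2 P) :
    (secondMoment P X).PosSemidef := by
  have h : secondMoment P X = Matrix.gram ℝ fun i => (hX.eval_piLp i).toLp := by
    ext i j
    rw [Matrix.gram_apply, L2.inner_def]
    refine integral_congr_ae ?_
    filter_upwards [(hX.eval_piLp i).coeFn_toLp, (hX.eval_piLp j).coeFn_toLp] with ω h1 h2
    rw [h1, h2, RCLike.inner_apply, conj_trivial, mul_comm]
  rw [h]
  exact Matrix.posSemidef_gram _ _

/-- A second moment matrix is a Gram matrix in `L²`. No sign condition on `r * lam` is needed: if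
the integral does not exist, `stochInt` is `0`. -/
lemma radialC2_posSemidef [NeZero d] (lam r : ℝ) : (radialC2 P Z H lam r).PosSemidef := by
  refine secondMoment_posSemidef ?_
  rw [itofbf, stochInt]
  split_ifs with h
  · exact h.choose_spec.2.1
  · exact MemLp.zero

variable [IsProbabilityMeasure P]

lemma IsGaussianISRM.isITOFBF_itofbf [NeZero d] (hQ : Q.PosSemidef) (hZ : IsGaussianISRM P Q Z)
    (hH : IsHurst H) {lam : ℝ} (hlam : 0 < lam) : IsITOFBF P Z H lam (itofbf P Z H lam) :=
  fun x => hZ.isStochInt_stochInt hQ (memLp_itofbfKernel hH hlam x)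

/-- The variance of the field at `x` in terms of the radial matrix. -/
lemma IsGaussianISRM.kernelCov_itofbfKernel_self [NeZero d] (hQ : Q.PosSemidef)
    (hZ : IsGaussianISRM P Q Z) (hH : IsHurst H) {lam : ℝ} (hlam : 0 < lam)
    (x : EuclideanSpace ℝ (Fin d)) :
    kernelCov Q (itofbfKernel H lam x) (itofbfKernel H lam x) =
      matPow ‖x‖ H * radialC2 P Z H lam ‖x‖ * matPow ‖x‖ H.transpose := by
  rcases eq_or_ne x 0 with rfl | hx
  · rw [norm_zero, matPow_zero, Matrix.zero_mul, Matrix.zero_mul]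
    ext i j
    simp [kernelCov, itofbfKernel]
  · have hr : 0 < ‖x‖ := norm_pos_iff.2 hx
    set e : EuclideanSpace ℝ (Fin d) := EuclideanSpace.single 0 1 with he
    -- Isometry invariance moves `x` to `‖x‖ e₁`; the scaling law then extracts `‖x‖^H` on both
    -- sides.
    obtain ⟨U, hU⟩ := exists_linearIsometryEquiv_apply_eq (v := ‖x‖ • e) (w := x) (by
      simp [norm_smul, he])
    have h1 := kernelCov_itofbfKernel_isometry (Q := Q) (H := H) lam U (‖x‖ • e) (‖x‖ • e)
    rw [hU] at h1
    rw [h1, kernelCov_itofbfKernel_smul hH hlam hr, radialC2,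
      hZ.secondMoment_of_isStochInt hQ (hZ.isITOFBF_itofbf hQ hH (mul_pos hr hlam) e)]

end Field

theorem corollary5p2 {Ω : Type*} [MeasurableSpace Ω] (P : Measure Ω) [IsProbabilityMeasure P]
    (d n : ℕ) [NeZero d] (Q : Matrix (Fin n) (Fin n) ℝ) (hQ : Q.PosSemidef)
    (Z : Set (EuclideanSpace ℝ (Fin d)) → Ω → EuclideanSpace ℝ (Fin n))
    (hZ : IsGaussianISRM P Q Z)
    (H : Matrix (Fin n) (Fin n) ℝ) (hH : IsHurst H) :
    -- the fields exist as genuine stochastic integrals, for every tempering parameter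
    (∀ mu : ℝ, 0 < mu → IsITOFBF P Z H mu (itofbf P Z H mu)) ∧
    ∀ (lam : ℝ), 0 < lam →
    ∀ (B : EuclideanSpace ℝ (Fin d) → Ω → EuclideanSpace ℝ (Fin n)), IsITOFBF P Z H lam B →
      IsIsotropicField P B ∧
      (∀ x, MemLp (B x) 2 P) ∧
      (∀ x : EuclideanSpace ℝ (Fin d), (radialC2 P Z H lam ‖x‖).PosSemidef) ∧
      ∀ x x' : EuclideanSpace ℝ (Fin d),
        covMatrix P (B x) (B x') = (1 / 2 : ℝ) •
          (matPow ‖x‖ H * radialC2 P Z H lam ‖x‖ * matPow ‖x‖ H.transpose +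
            matPow ‖x'‖ H * radialC2 P Z H lam ‖x'‖ * matPow ‖x'‖ H.transpose -
            matPow ‖x - x'‖ H * radialC2 P Z H lam ‖x - x'‖ *
              matPow ‖x - x'‖ H.transpose) := by
  refine ⟨fun mu hmu => hZ.isITOFBF_itofbf hQ hH hmu, fun lam hlam B hB =>
    ⟨fun O hO m x => ?_, fun x => (hB x).2.1, fun x => radialC2_posSemidef _ _, fun x x' => ?_⟩⟩
  · obtain ⟨U, hU⟩ := exists_linearIsometryEquiv_of_mem_orthogonalGroup hO
    refine hZ.identDistrib_of_isStochInt hQ (fun k => hB _) (fun k => hB _) fun k l => ?_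
    rw [← hU, ← hU, kernelCov_itofbfKernel_isometry]
  · rw [hZ.covMatrix_of_isStochInt hQ (hB x) (hB x'),
      kernelCov_itofbfKernel_polarization hQ hH hlam,
      hZ.kernelCov_itofbfKernel_self hQ hH hlam, hZ.kernelCov_itofbfKernel_self hQ hH hlam,
      hZ.kernelCov_itofbfKernel_self hQ hH hlam]
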